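/- Let $Z$ be the centre of $U(2)$ (the circle of scalar matrices), and let $p\colon U(2)\to PU(2)=U(2)/Z\cong SO(3)$ be the projection, given by the conjugation action of $U(2)$ on the Euclidean $3$-space of traceless Hermitian $2\times 2$ matrices. Write $C_n\subset Z$ for the cyclic subgroup of order $n$. Let $H$ be a subgroup of $SO(3)$ which is either $SO(3)$ itself or is isomorphic to $A_5$, $\Sigma_4$, $A_4$ or $D_4$ (the dihedral group of order $4$). Let $\tilde H=p^{-1}H\cap SU(2)$ be its double cover, so that $\tilde H\cap Z=C_2$ and $p^{-1}H=\tilde H Z=\tilde H\times_{C_2}Z$. A closed subgroup $K\subseteq p^{-1}H$ is called full if $p(K)=H$; all full subgroups below are understood to be closed. For $s\ge 1$ the canonical lift is $\tilde H_s=\langle \tilde H, C_{2s}\rangle$. (i) If $K$ is a full subgroup of $p^{-1}H$ with $K\neq p^{-1}H$, then $K\cap Z$ is a finite group of even order. (ii) (Classification up to conjugacy in $p^{-1}H$.) Every full subgroup of $p^{-1}H$ is either $\tilde H\times_{C_2}Z=p^{-1}H$, which is the only one of top dimension (all others have strictly smaller dimension as Lie groups), or meets $Z$ in $C_{2s}$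 for some $s\ge 1$. For each $s\ge 1$ there are exactly $a(H)$ $p^{-1}H$-conjugacy classes of full subgroups $K$ with $K\cap Z=C_{2s}$, where $a(H)=1,1,2,3,4$ for $H\cong SO(3),A_5,\Sigma_4,A_4,D_4$ respectively. All full subgroups are normal in $p^{-1}H$. For each $s\geq 1$ the canonical lift $\tilde H_s$ is a full subgroup with $\tilde H_s\cap Z=C_{2s}$, so it represents one of these classes. (iii) (Classification up to conjugacy in $U(2)$.) For each $s\ge 1$, any two full subgroups of $p^{-1}H$ that meet $Z$ in $C_{2s}$ and are different from $\tilde H_s$ are conjugate in $U(2)$. The set of $U(2)$-conjugacy classes of full subgroups of $p^{-1}H$ contains a single class of top dimension, that of $\tilde H\times_{C_2}Z$, and for each $s\ge 1$ exactly $b(H)$ classes of full subgroups meeting $Z$ in $C_{2s}$, where $b(H)=1,1,2,2,2$ for $H\cong SO(3),A_5,\Sigma_4,A_4,D_4$ respectively. -/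

import Mathlib

open Matrix

/-- The unitary group `U(2)`. -/
abbrev U2 : Type := Matrix.unitaryGroup (Fin 2) ℂ

/-- The rotation group `SO(3)`. -/
abbrev SO3 : Type := Matrix.specialOrthogonalGroup (Fin 3) ℝ

/-- The Pauli matrices, a basis of the real 3-dimensional space of traceless Hermitian
`2 × 2` matrices, orthonormal for the inner product `⟨A, B⟩ = tr (A B) / 2`. -/
noncomputable def pauli : Fin 3 → Matrix (Fin 2) (Fin 2) ℂ :=
  ![!![0, 1; 1, 0], !![0, -Complex.I; Complex.I, 0], !![1, 0; 0, -1]]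

/-- The matrix, in the orthonormal basis of Pauli matrices, of the conjugation `X ↦ u X uᴴ` on
traceless Hermitian matrices. -/
noncomputable def adMatrix (u : Matrix (Fin 2) (Fin 2) ℂ) : Matrix (Fin 3) (Fin 3) ℝ :=
  Matrix.of fun i j => (1 / 2) * (Matrix.trace (pauli i * (u * pauli j * uᴴ))).re

theorem pauli_expand (M : Matrix (Fin 2) (Fin 2) ℂ) (hM : Mᴴ = M) (ht : M.trace = 0) :
    M = ∑ k, (((1 / 2) * (Matrix.trace (pauli k * M)).re : ℝ) : ℂ) • pauli k := by
  have h00 := congrFun (congrFun hM 0) 0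
  have h01 := congrFun (congrFun hM 0) 1
  have h11 := congrFun (congrFun hM 1) 1
  simp only [Matrix.conjTranspose_apply, Complex.ext_iff, Complex.star_def, Complex.conj_re,
    Complex.conj_im, Matrix.trace_fin_two, Complex.add_re, Complex.add_im, Complex.zero_re,
    Complex.zero_im] at h00 h01 h11 ht
  ext i j
  fin_cases i <;> fin_cases j <;>
    simp [pauli, Fin.sum_univ_three, Matrix.trace_fin_two, Matrix.vecMul, dotProduct,
      Complex.ext_iff] <;>
    constructor <;> linarith

theorem pauli_hermitian (i : Fin 3) : (pauli i)ᴴ = pauli i := by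
  ext a b
  fin_cases i <;> fin_cases a <;> fin_cases b <;> simp [pauli]

theorem pauli_trace (i : Fin 3) : (pauli i).trace = 0 := by
  fin_cases i <;> simp [pauli, Matrix.trace_fin_two]

theorem pauli_orthonormal (i j : Fin 3) :
    (Matrix.trace (pauli i * pauli j)).re = if i = j then 2 else 0 := by
  fin_cases i <;> fin_cases j <;>
    simp [pauli, Matrix.trace_fin_two] <;> norm_num

theorem conj_pauli (u : U2) (j : Fin 3) :
    u.1 * pauli j * u.1ᴴ = ∑ k, ((adMatrix u.1 k j : ℝ) : ℂ) • pauli k := by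
  refine pauli_expand _ ?_ ?_
  · simp [Matrix.conjTranspose_mul, pauli_hermitian, Matrix.mul_assoc]
  · have h : u.1ᴴ * u.1 = 1 := Matrix.mem_unitaryGroup_iff'.1 u.2
    rw [Matrix.trace_mul_comm, ← Matrix.mul_assoc, h, Matrix.one_mul, pauli_trace]

theorem adMatrix_one : adMatrix 1 = 1 := by
  ext i j
  simp only [adMatrix, Matrix.of_apply, Matrix.one_mul, Matrix.conjTranspose_one, Matrix.mul_one,
    pauli_orthonormal, Matrix.one_apply]
  split_ifs <;> norm_num

theorem adMatrix_mul (u v : U2) : adMatrix (u.1 * v.1) = adMatrix u.1 * adMatrix v.1 := by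
  ext i j
  have h : u.1 * v.1 * pauli j * (u.1 * v.1)ᴴ
      = ∑ k, ((adMatrix v.1 k j : ℝ) : ℂ) • (u.1 * pauli k * u.1ᴴ) := by
    have : u.1 * v.1 * pauli j * (u.1 * v.1)ᴴ = u.1 * (v.1 * pauli j * v.1ᴴ) * u.1ᴴ := by
      simp only [Matrix.conjTranspose_mul, Matrix.mul_assoc]
    rw [this, conj_pauli v j]
    simp [Finset.mul_sum, Finset.sum_mul]
  rw [adMatrix, Matrix.of_apply, h, Matrix.mul_apply]
  simp only [Matrix.trace_sum, Matrix.mul_smul, Matrix.trace_smul, Complex.re_sum,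
    Finset.mul_sum, smul_eq_mul, Complex.re_ofReal_mul]
  refine Finset.sum_congr rfl fun k _ => ?_
  simp only [adMatrix, Matrix.of_apply]
  ring

theorem adMatrix_conjTranspose (u : Matrix (Fin 2) (Fin 2) ℂ) :
    adMatrix uᴴ = (adMatrix u)ᵀ := by
  ext i j
  simp only [adMatrix, Matrix.of_apply, Matrix.transpose_apply, Matrix.conjTranspose_conjTranspose]
  congr 2
  calc Matrix.trace (pauli i * (uᴴ * pauli j * u))
      = Matrix.trace ((pauli i * uᴴ * pauli j) * u) := by simp only [Matrix.mul_assoc]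
    _ = Matrix.trace (u * (pauli i * uᴴ * pauli j)) := Matrix.trace_mul_comm _ _
    _ = Matrix.trace ((u * pauli i * uᴴ) * pauli j) := by simp only [Matrix.mul_assoc]
    _ = Matrix.trace (pauli j * (u * pauli i * uᴴ)) := Matrix.trace_mul_comm _ _

theorem pauli_triple (P : Matrix (Fin 3) (Fin 3) ℝ) :
    Matrix.trace ((∑ k, ((P k 0 : ℝ) : ℂ) • pauli k) * (∑ k, ((P k 1 : ℝ) : ℂ) • pauli k) *
      (∑ k, ((P k 2 : ℝ) : ℂ) • pauli k)) = 2 * Complex.I * ((P.det : ℝ) : ℂ) := by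
  simp [pauli, Fin.sum_univ_three, Matrix.trace_fin_two, Matrix.det_fin_three,
    Complex.ext_iff]
  constructor <;> ring

theorem adMatrix_mem (u : U2) : adMatrix u.1 ∈ Matrix.specialOrthogonalGroup (Fin 3) ℝ := by
  have h : u.1ᴴ * u.1 = 1 := Matrix.mem_unitaryGroup_iff'.1 u.2
  have h' : u.1 * u.1ᴴ = 1 := Matrix.mem_unitaryGroup_iff.1 u.2
  rw [Matrix.mem_specialOrthogonalGroup_iff, Matrix.mem_orthogonalGroup_iff]
  constructor
  · have := adMatrix_mul u (star u)
    rw [show (star u).1 = u.1ᴴ from rfl, h', adMatrix_one, adMatrix_conjTranspose] at this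
    exact this.symm
  · have h3 := pauli_triple (adMatrix u.1)
    simp only [← conj_pauli] at h3
    have e : u.1 * pauli 0 * u.1ᴴ * (u.1 * pauli 1 * u.1ᴴ) * (u.1 * pauli 2 * u.1ᴴ)
        = u.1 * (pauli 0 * pauli 1 * pauli 2 * u.1ᴴ) := by
      calc _ = u.1 * pauli 0 * (u.1ᴴ * u.1) * pauli 1 * (u.1ᴴ * u.1) * pauli 2 * u.1ᴴ := by
            simp only [Matrix.mul_assoc]
        _ = _ := by rw [h]; simp only [Matrix.mul_assoc, Matrix.one_mul]
    rw [e, Matrix.trace_mul_comm, Matrix.mul_assoc, h, Matrix.mul_one] at h3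
    simp [pauli, Matrix.trace_fin_two, Complex.ext_iff] at h3
    linarith

/-- The projection `p : U(2) → SO(3)`: the action of `U(2)` by conjugation on the Euclidean
3-space of traceless Hermitian matrices. Its kernel is the centre (`projSO3_ker`) and it is
surjective (`projSO3_surjective`), so it identifies `PU(2) = U(2)/Z` with `SO(3)`. -/
noncomputable def projSO3 : U2 →* SO3 where
  toFun u := ⟨adMatrix u.1, adMatrix_mem u⟩
  map_one' := Subtype.ext adMatrix_one
  map_mul' u v := Subtype.ext (adMatrix_mul u v)

theorem pauli_mem (i : Fin 3) : pauli i ∈ Matrix.unitaryGroup (Fin 2) ℂ := by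
  rw [Matrix.mem_unitaryGroup_iff, Matrix.star_eq_conjTranspose, pauli_hermitian]
  ext a b
  fin_cases i <;> fin_cases a <;> fin_cases b <;> simp [pauli, Matrix.mul_apply]

theorem projSO3_ker : projSO3.ker = Subgroup.center U2 := by
  ext u
  have h : u.1ᴴ * u.1 = 1 := Matrix.mem_unitaryGroup_iff'.1 u.2
  have h' : u.1 * u.1ᴴ = 1 := Matrix.mem_unitaryGroup_iff.1 u.2
  rw [MonoidHom.mem_ker, Subgroup.mem_center_iff]
  constructor
  · intro hu
    have hu' : adMatrix u.1 = 1 := congrArg Subtype.val hu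
    have hc : ∀ j, u.1 * pauli j = pauli j * u.1 := by
      intro j
      have h1 := conj_pauli u j
      rw [hu'] at h1
      have h2 : u.1 * pauli j * u.1ᴴ = pauli j := by
        rw [h1]; simp [Matrix.one_apply]
      calc u.1 * pauli j = u.1 * pauli j * (u.1ᴴ * u.1) := by rw [h, Matrix.mul_one]
        _ = (u.1 * pauli j * u.1ᴴ) * u.1 := by simp only [Matrix.mul_assoc]
        _ = _ := by rw [h2]
    have e1 := congrFun (congrFun (hc 2) 0) 1
    have e2 := congrFun (congrFun (hc 2) 1) 0
    have e3 := congrFun (congrFun (hc 0) 0) 1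
    simp [pauli, Matrix.mul_apply] at e1 e2 e3
    have z1 : u.1 0 1 = 0 := by linear_combination (-1 / 2 : ℂ) * e1
    have z2 : u.1 1 0 = 0 := by linear_combination (1 / 2 : ℂ) * e2
    intro g
    apply Subtype.ext
    change g.1 * u.1 = u.1 * g.1
    ext a b
    fin_cases a <;> fin_cases b <;> simp [Matrix.mul_apply, z1, z2, e3, mul_comm]
  · intro hu
    apply Subtype.ext
    change adMatrix u.1 = 1
    ext i j
    have h1 : pauli j * u.1 = u.1 * pauli j := congrArg Subtype.val (hu ⟨pauli j, pauli_mem j⟩)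
    rw [adMatrix, Matrix.of_apply, ← h1, Matrix.mul_assoc (pauli j), h', Matrix.mul_one,
      pauli_orthonormal, Matrix.one_apply]
    split_ifs <;> norm_num

theorem conjTranspose_two (a b c d : ℂ) :
    !![a, b; c, d]ᴴ = !![star a, star c; star b, star d] := by
  ext i j
  fin_cases i <;> fin_cases j <;> rfl

/-- Half turns lie in the image of the projection. -/
theorem halfTurn_mem (n : Fin 3 → ℝ) (hn : n 0 ^ 2 + n 1 ^ 2 + n 2 ^ 2 = 1) :
    ∃ u : U2, adMatrix u.1 = Matrix.of fun i j => 2 * n i * n j - if i = j then 1 else 0 := by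
  have hmem : (∑ k, ((n k : ℝ) : ℂ) • pauli k) ∈ Matrix.unitaryGroup (Fin 2) ℂ := by
    rw [Matrix.mem_unitaryGroup_iff]
    ext a b
    fin_cases a <;> fin_cases b <;>
      simp [pauli, Matrix.mul_apply, Fin.sum_univ_three, Complex.ext_iff, Matrix.star_apply] <;>
      constructor <;> nlinarith [hn]
  refine ⟨⟨_, hmem⟩, ?_⟩
  ext i j
  fin_cases i <;> fin_cases j <;>
    simp [adMatrix, pauli, Fin.sum_univ_three, Matrix.trace_fin_two, conjTranspose_two] <;>
    nlinarith [hn]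

/-- Rotations about the third axis lie in the image of the projection. -/
theorem rotation_mem (c s : ℝ) (h : c ^ 2 + s ^ 2 = 1) :
    ∃ u : U2, adMatrix u.1 = !![c, -s, 0; s, c, 0; 0, 0, 1] := by
  have hmem : !![1, 0; 0, (c : ℂ) + s * Complex.I] ∈ Matrix.unitaryGroup (Fin 2) ℂ := by
    rw [Matrix.mem_unitaryGroup_iff]
    ext a b
    fin_cases a <;> fin_cases b <;>
      simp [Matrix.mul_apply, Complex.ext_iff, Matrix.star_apply]
    constructor <;> nlinarith [h]
  refine ⟨⟨_, hmem⟩, ?_⟩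
  ext i j
  fin_cases i <;> fin_cases j <;>
    simp [adMatrix, pauli, Matrix.trace_fin_two, conjTranspose_two] <;>
    nlinarith [h]

theorem projSO3_surjective : Function.Surjective projSO3 := by
  -- A rotation fixing the third axis is in the image.
  have key : ∀ R : SO3, R.1 0 2 = 0 → R.1 1 2 = 0 → R.1 2 2 = 1 → ∃ u, projSO3 u = R := by
    intro R h0 h1 h2
    obtain ⟨ho, hd⟩ := Matrix.mem_specialOrthogonalGroup_iff.1 R.2
    have hoo := (Matrix.mem_orthogonalGroup_iff' _ _).1 ho
    have g (i j : Fin 3) := congrFun (congrFun hoo i) j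
    have g00 := g 0 0
    have g02 := g 0 2
    have g12 := g 1 2
    have g01 := g 0 1
    have g11 := g 1 1
    simp [Matrix.mul_apply, Fin.sum_univ_three, Matrix.star_apply, h0, h1, h2]
      at g00 g02 g12 g01 g11
    rw [Matrix.det_fin_three] at hd
    simp only [h0, h1, h2, g02, g12] at hd g00 g01 g11
    have e1 : R.1 1 1 = R.1 0 0 := by
      linear_combination (-R.1 1 1) * g00 + R.1 1 0 * g01 + R.1 0 0 * hd
    have e2 : R.1 0 1 = -R.1 1 0 := by
      linear_combination (-R.1 0 1) * g00 + R.1 0 0 * g01 - R.1 1 0 * hd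
    obtain ⟨u, hu⟩ := rotation_mem (R.1 0 0) (R.1 1 0) (by linarith)
    refine ⟨u, Subtype.ext ?_⟩
    change adMatrix u.1 = R.1
    rw [hu]
    ext i j
    fin_cases i <;> fin_cases j <;> simp [h0, h1, h2, g02, g12, e1, e2]
  intro R
  obtain ⟨ho, hd⟩ := Matrix.mem_specialOrthogonalGroup_iff.1 R.2
  have hoo := (Matrix.mem_orthogonalGroup_iff' _ _).1 ho
  have g22 := congrFun (congrFun hoo 2) 2
  simp [Matrix.mul_apply, Fin.sum_univ_three, Matrix.star_apply] at g22
  -- A half turn sends the image of the third basis vector back to that vector.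
  have hn : ∃ n : Fin 3 → ℝ, n 0 ^ 2 + n 1 ^ 2 + n 2 ^ 2 = 1 ∧
      2 * n 0 * (n 0 * R.1 0 2 + n 1 * R.1 1 2 + n 2 * R.1 2 2) = R.1 0 2 ∧
      2 * n 1 * (n 0 * R.1 0 2 + n 1 * R.1 1 2 + n 2 * R.1 2 2) = R.1 1 2 ∧
      2 * n 2 * (n 0 * R.1 0 2 + n 1 * R.1 1 2 + n 2 * R.1 2 2) = 1 + R.1 2 2 := by
    generalize R.1 0 2 = x at *
    generalize R.1 1 2 = y at *
    generalize R.1 2 2 = z at *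
    by_cases hz : z = -1
    · have hx : x = 0 := by nlinarith [mul_self_nonneg x, mul_self_nonneg y]
      have hy : y = 0 := by nlinarith [mul_self_nonneg x, mul_self_nonneg y]
      exact ⟨![1, 0, 0], by simp [hx, hy, hz]⟩
    · have hz1 : 0 < 1 + z := by
        have : -1 ≤ z := by nlinarith [mul_self_nonneg x, mul_self_nonneg y]
        rcases this.lt_or_eq with h | h
        · linarith
        · exact absurd h.symm hz
      set r := Real.sqrt (2 * (1 + z)) with hr
      have hr2 : r * r = 2 * (1 + z) := Real.mul_self_sqrt (by linarith)
      have hr0 : r ≠ 0 := by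
        intro h; rw [h] at hr2; linarith
      have hdot : x / r * x + y / r * y + (1 + z) / r * z = r / 2 := by
        field_simp
        nlinarith
      refine ⟨![x / r, y / r, (1 + z) / r], ?_, ?_, ?_, ?_⟩
      · simp
        field_simp
        nlinarith
      all_goals
        simp only [Matrix.cons_val_zero, Matrix.cons_val_one, Matrix.cons_val]
        rw [hdot]
        field_simp
  obtain ⟨n, hn1, k0, k1, k2⟩ := hn
  obtain ⟨v, hv⟩ := halfTurn_mem n hn1
  have hcol : ∀ i, (projSO3 v * R).1 i 2 = ∑ k, adMatrix v.1 i k * R.1 k 2 := fun i => by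
    change (adMatrix v.1 * R.1) i 2 = _
    rw [Matrix.mul_apply]
  obtain ⟨w, hw⟩ := key (projSO3 v * R)
    (by rw [hcol, hv]; simp [Fin.sum_univ_three]; linarith)
    (by rw [hcol, hv]; simp [Fin.sum_univ_three]; linarith)
    (by rw [hcol, hv]; simp [Fin.sum_univ_three]; linarith)
  exact ⟨v⁻¹ * w, by rw [map_mul, map_inv, hw, inv_mul_cancel_left]⟩

/-- The five isomorphism types of totally isolated subgroups of `SO(3)`. -/
inductive EasyType
  | rotation
  | icosahedral
  | octahedral
  | tetrahedral
  | klein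

/-- `H` is a subgroup of `SO(3)` of the given type: all of `SO(3)`, or a subgroup isomorphic to
`A₅`, `Σ₄`, `A₄`, or to the dihedral group `D₄` of order 4. -/
def EasyType.Is : EasyType → Subgroup SO3 → Prop
  | .rotation, H => H = ⊤
  | .icosahedral, H => Nonempty (H ≃* alternatingGroup (Fin 5))
  | .octahedral, H => Nonempty (H ≃* Equiv.Perm (Fin 4))
  | .tetrahedral, H => Nonempty (H ≃* alternatingGroup (Fin 4))
  | .klein, H => Nonempty (H ≃* DihedralGroup 2)

/-- The numbers `a(H)`. -/
def EasyType.a : EasyType → ℕ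
  | .rotation => 1
  | .icosahedral => 1
  | .octahedral => 2
  | .tetrahedral => 3
  | .klein => 4

/-- The numbers `b(H)`. -/
def EasyType.b : EasyType → ℕ
  | .rotation => 1
  | .icosahedral => 1
  | .octahedral => 2
  | .tetrahedral => 2
  | .klein => 2

/-- The centre `Z` of `U(2)`, the circle group of scalar matrices. -/
abbrev Z2 : Subgroup U2 := Subgroup.center U2

/-- The subgroup `C_n` of the circle `Z` (the elements of `Z` with `z ^ n = 1`). -/
def cyc (n : ℕ) : Subgroup U2 where
  carrier := {u | u ∈ Z2 ∧ u ^ n = 1}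
  one_mem' := ⟨one_mem _, one_pow n⟩
  mul_mem' := by
    rintro u v ⟨hu, hu'⟩ ⟨hv, hv'⟩
    have hc : Commute u v := Subgroup.mem_center_iff.1 hv u
    exact ⟨mul_mem hu hv, by rw [hc.mul_pow, hu', hv', one_mul]⟩
  inv_mem' := by
    rintro u ⟨hu, hu'⟩
    exact ⟨inv_mem hu, by rw [inv_pow, hu', inv_one]⟩

/-- The special unitary group `SU(2)` as a subgroup of `U(2)`. -/
def SU2 : Subgroup U2 where
  carrier := {u | u.1.det = 1}
  one_mem' := Matrix.det_one
  mul_mem' := by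
    intro u v (hu : u.1.det = 1) (hv : v.1.det = 1)
    change (u.1 * v.1).det = 1
    rw [Matrix.det_mul, hu, hv, one_mul]
  inv_mem' := by
    intro u (hu : u.1.det = 1)
    change (u.1ᴴ).det = 1
    rw [Matrix.det_conjTranspose, hu, star_one]

/-- The inverse image `p⁻¹H` in `U(2)`. -/
noncomputable def preim (H : Subgroup SO3) : Subgroup U2 := H.comap projSO3

/-- The double cover `H̃ = p⁻¹H ∩ SU(2)` of `H`. -/
noncomputable def dbl (H : Subgroup SO3) : Subgroup U2 := preim H ⊓ SU2

/-- The canonical lift `H̃_s = ⟨H̃, C_{2s}⟩`. -/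
noncomputable def canonicalLift (H : Subgroup SO3) (s : ℕ) : Subgroup U2 := dbl H ⊔ cyc (2 * s)

/-- The full subgroups of `p⁻¹H`: the closed subgroups `K` of `p⁻¹H` with `p(K) = H`. -/
def fullSubgroups (H : Subgroup SO3) : Set (Subgroup U2) :=
  {K | IsClosed (K : Set U2) ∧ K ≤ preim H ∧ K.map projSO3 = H}

/-- The full subgroups of `p⁻¹H` meeting `Z` in `C_n`. -/
def fullMeeting (H : Subgroup SO3) (n : ℕ) : Set (Subgroup U2) :=
  {K | K ∈ fullSubgroups H ∧ K ⊓ Z2 = cyc n}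

/-- The `L`-conjugacy class of a subgroup `K` of `U(2)`: all `g K g⁻¹` with `g ∈ L`. -/
def conjClass (L K : Subgroup U2) : Set (Subgroup U2) :=
  {K' | ∃ g ∈ L, K' = K.map (MulAut.conj g).toMonoidHom}

/-- The set of `L`-conjugacy classes of the subgroups in `S`. -/
def conjClasses (L : Subgroup U2) (S : Set (Subgroup U2)) : Set (Set (Subgroup U2)) :=
  conjClass L '' S

/-- The dimension of a closed subgroup `K` of `U(2)` as a Lie group: the real dimension of its Lie
algebra `{X | exp (t X) ∈ K for all real t}`. (For closed `K` this set is a real subspace, so that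
taking its span changes nothing.) -/
noncomputable def lieDim (K : Subgroup U2) : ℕ :=
  Module.finrank ℝ (Submodule.span ℝ
    {X : Matrix (Fin 2) (Fin 2) ℂ | ∀ t : ℝ, ∃ u ∈ K, u.1 = NormedSpace.exp (t • X)})

/-!
Let `K` be a full subgroup of `p⁻¹H`. Since `p⁻¹H = K Z` with `Z` central, `K` is normal in `p⁻¹H`.
The intersection `K ∩ Z` is a closed subgroup of the circle. If it is all of `Z`, then `K = p⁻¹H`.
Otherwise it is a group `C_n` of roots of unity, and `n` is even: `H` contains two distinct commuting
half turns (`EasyType.exists_kleinPair`), whose lifts to `U(2)` anticommute (`KleinPair.exists_lift`),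
so that `-1` is a commutator in `K` (`neg_one_mem_of_kleinPair`).

If `K ∩ Z = C_{2s}`, then `det(u)ˢ` for `u ∈ K` depends only on `p(u)`, because `det(z)ˢ = z²ˢ` for
scalars `z`. This defines a character `χ : H → S¹`, and `K` is recovered as the group `charLift H s χ`
of all `u ∈ p⁻¹H` with `det(u)ˢ = χ(p(u))`. Conversely each character arises in this way, and the
trivial one gives the canonical lift. Hence the full subgroups meeting `Z` in `C_{2s}` correspond to
the characters of `H`, and `a(H)` is the number of these (`EasyType.card_characters`): the index of
the commutator subgroup in the finite cases, and one for `SO(3)`, which is perfect (`commutator_SO3`).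

Conjugation by `u ∈ U(2)` acts on the characters through the normalizer of `H` in `SO(3)`, so that
the classification in `U(2)` asks for the orbits of this normalizer (`exists_conjChar`). The trivial
character is fixed, and the nontrivial ones form at most one orbit. For a Klein four-group and a
tetrahedral group, which alone have more than one nontrivial character, this uses one kind of
rotation: for commuting half turns `x ≠ y` the half turn about a bisector of their axes
interchanges `x` and `y` (`KleinPair.exists_swap`). For the Klein four-group such rotations permute the
three nontrivial characters transitively. For a tetrahedral group, where `x` and `y` generate the Klein
four-group `V` and `t` is an element of order three, conjugation by such a `g` inverts the action of
`t` on `V`; since `V` is its own centralizer (`KleinPair.eq_of_commute`), `g t g⁻¹ ∈ V t⁻¹`, so that `g`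
normalizes `H` and exchanges its two nontrivial characters.

Finally, characters of `H` have finite order, so that `det` takes only finitely many values on `K`.
Hence the Lie algebra of `K` is traceless (`trace_eq_zero_of_det_exp_pow`), while that of `p⁻¹H`
contains the scalars, which gives the inequality of dimensions.
-/

/-! ### The circle of scalar matrices and the determinant -/

/-- The scalar matrices, as a homomorphism from the circle to `U(2)`. -/
noncomputable def scalarHom : Circle →* U2 where
  toFun z := ⟨(z : ℂ) • (1 : Matrix (Fin 2) (Fin 2) ℂ), by
    rw [Matrix.mem_unitaryGroup_iff, star_smul, star_one, smul_mul_smul_comm, mul_one,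
      Complex.star_def, Complex.mul_conj, Circle.normSq_coe, Complex.ofReal_one, one_smul]⟩
  map_one' := Subtype.ext (by simp)
  map_mul' z w := Subtype.ext (by simp [smul_smul, mul_comm])

theorem scalarHom_coe (z : Circle) :
    (scalarHom z).1 = (z : ℂ) • (1 : Matrix (Fin 2) (Fin 2) ℂ) := rfl

theorem scalarHom_injective : Function.Injective scalarHom := by
  intro z w h
  have h' := congrFun (congrFun (congrArg Subtype.val h) 0) 0
  simpa [scalarHom_coe, Circle.ext_iff] using h'

theorem norm_det_eq_one (u : U2) : ‖u.1.det‖ = 1 := by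
  have h := Matrix.det_of_mem_unitary u.2
  exact CStarRing.norm_of_mem_unitary h

/-- The determinant, as a homomorphism from `U(2)` to the circle. -/
noncomputable def detHom : U2 →* Circle where
  toFun u := ⟨u.1.det, mem_sphere_zero_iff_norm.2 (norm_det_eq_one u)⟩
  map_one' := Circle.ext Matrix.det_one
  map_mul' u v := Circle.ext (Matrix.det_mul u.1 v.1)

theorem detHom_coe (u : U2) : ((detHom u : Circle) : ℂ) = u.1.det := rfl

theorem detHom_scalarHom (z : Circle) : detHom (scalarHom z) = z ^ 2 := by
  apply Circle.ext
  simp [detHom_coe, scalarHom_coe, pow_two]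

theorem mem_SU2_iff {u : U2} : u ∈ SU2 ↔ detHom u = 1 := by
  rw [Circle.ext_iff, detHom_coe]
  rfl

theorem center_eq_range_scalarHom : Z2 = scalarHom.range := by
  ext u
  constructor
  · intro hu
    -- A matrix commuting with two Pauli matrices is scalar.
    have hc (j : Fin 3) : pauli j * u.1 = u.1 * pauli j :=
      congrArg Subtype.val (Subgroup.mem_center_iff.1 hu ⟨pauli j, pauli_mem j⟩)
    have e1 := congrFun (congrFun (hc 2) 0) 1
    have e2 := congrFun (congrFun (hc 2) 1) 0
    have e3 := congrFun (congrFun (hc 0) 0) 1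
    simp [pauli, Matrix.mul_apply] at e1 e2 e3
    have z1 : u.1 0 1 = 0 := by linear_combination (1 / 2 : ℂ) * e1
    have z2 : u.1 1 0 = 0 := by linear_combination (-1 / 2 : ℂ) * e2
    have hn : ‖u.1 0 0‖ = 1 := by
      have h := congrFun (congrFun (Matrix.mem_unitaryGroup_iff.1 u.2) 0) 0
      simp [Matrix.mul_apply, Matrix.star_apply, z1, Complex.mul_conj] at h
      rw [Complex.normSq_eq_norm_sq] at h
      have h2 : ‖u.1 0 0‖ ^ 2 = 1 := by exact_mod_cast h
      nlinarith [norm_nonneg (u.1 0 0)]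
    refine ⟨⟨u.1 0 0, mem_sphere_zero_iff_norm.2 hn⟩, Subtype.ext ?_⟩
    change (u.1 0 0) • (1 : Matrix (Fin 2) (Fin 2) ℂ) = u.1
    ext i j
    fin_cases i <;> fin_cases j <;> simp [z1, z2, e3]
  · rintro ⟨z, rfl⟩
    refine Subgroup.mem_center_iff.2 fun g => Subtype.ext ?_
    change g.1 * (scalarHom z).1 = (scalarHom z).1 * g.1
    simp [scalarHom_coe]

theorem scalarHom_mem_center (z : Circle) : scalarHom z ∈ Z2 := by
  rw [center_eq_range_scalarHom]
  exact ⟨z, rfl⟩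

theorem projSO3_scalarHom (z : Circle) : projSO3 (scalarHom z) = 1 := by
  rw [← MonoidHom.mem_ker, projSO3_ker]
  exact scalarHom_mem_center z

/-- Two unitary matrices with the same projection differ by a scalar. -/
theorem exists_eq_mul_scalarHom {u v : U2} (h : projSO3 u = projSO3 v) :
    ∃ z, u = v * scalarHom z := by
  have hk : v⁻¹ * u ∈ Z2 := by
    rw [Z2, ← projSO3_ker, MonoidHom.mem_ker, map_mul, map_inv, h, inv_mul_cancel]
  rw [center_eq_range_scalarHom] at hk
  obtain ⟨z, hz⟩ := hk
  exact ⟨z, by rw [hz, mul_inv_cancel_left]⟩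

theorem Circle.exists_pow_eq {n : ℕ} (hn : n ≠ 0) (w : Circle) : ∃ z : Circle, z ^ n = w := by
  refine ⟨Circle.exp (Complex.arg w / n), ?_⟩
  rw [← Circle.exp_natCast_mul, mul_div_cancel₀ _ (Nat.cast_ne_zero.2 hn), Circle.exp_arg]

/-- Every unitary matrix is a scalar multiple of a special unitary one. -/
theorem exists_eq_SU2_mul_scalarHom (u : U2) :
    ∃ v ∈ SU2, ∃ z, z ^ 2 = detHom u ∧ u = v * scalarHom z := by
  obtain ⟨z, hz⟩ := Circle.exists_pow_eq two_ne_zero (detHom u)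
  refine ⟨u * scalarHom z⁻¹, ?_, z, hz, by simp⟩
  rw [mem_SU2_iff, map_mul, detHom_scalarHom, inv_pow, hz, mul_inv_cancel]

theorem scalarHom_mem_cyc {z : Circle} {n : ℕ} : scalarHom z ∈ cyc n ↔ z ^ n = 1 := by
  change scalarHom z ∈ Z2 ∧ scalarHom z ^ n = 1 ↔ _
  rw [← map_pow, map_eq_one_iff _ scalarHom_injective]
  simp [scalarHom_mem_center]

theorem cyc_le_center (n : ℕ) : cyc n ≤ Z2 := fun _ h => h.1

/-- A closed subgroup of the circle is either everything or a group of roots of unity: its inverse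
image in `ℝ` is either dense or cyclic. -/
theorem Circle.eq_top_or_eq_roots_of_isClosed (A : Subgroup Circle)
    (hA : IsClosed (A : Set Circle)) :
    A = ⊤ ∨ ∃ n : ℕ, n ≠ 0 ∧ ∀ z, z ∈ A ↔ z ^ n = 1 := by
  let B : AddSubgroup ℝ := (Subgroup.toAddSubgroup A).comap Circle.expHom
  have hB (t : ℝ) : t ∈ B ↔ Circle.exp t ∈ A := Iff.rfl
  rcases B.dense_or_cyclic with hd | ⟨a, ha⟩
  · left
    have hcl : IsClosed (B : Set ℝ) := hA.preimage Circle.exp.continuous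
    have huniv : (B : Set ℝ) = Set.univ := by rw [← hcl.closure_eq, hd.closure_eq]
    refine (Subgroup.eq_top_iff' _).2 fun z => ?_
    have : Complex.arg z ∈ (B : Set ℝ) := by rw [huniv]; trivial
    rw [SetLike.mem_coe, hB, Circle.exp_arg] at this
    exact this
  · right
    have hmem (t : ℝ) : Circle.exp t ∈ A ↔ ∃ k : ℤ, k * a = t := by
      rw [← hB, ha, AddSubgroup.mem_closure_singleton]
      simp
    obtain ⟨m, hm⟩ := (hmem (2 * Real.pi)).1 (by rw [Circle.exp_two_pi]; exact one_mem A)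
    have hm0 : m ≠ 0 := by
      rintro rfl
      simp [Real.pi_ne_zero] at hm
    refine ⟨m.natAbs, Int.natAbs_ne_zero.2 hm0, fun z => ?_⟩
    have hpow : z ^ m.natAbs = 1 ↔ z ^ m = 1 := by
      rcases Int.natAbs_eq m with h | h
      · rw [← zpow_natCast, ← h]
      · rw [← inv_eq_one, ← zpow_natCast, ← _root_.zpow_neg, ← h]
    rw [hpow, ← Circle.exp_arg z, hmem, ← Circle.exp_intCast_mul, Circle.exp_eq_one]
    have hmR : (m : ℝ) ≠ 0 := Int.cast_ne_zero.2 hm0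
    refine exists_congr fun k => ?_
    rw [← hm]
    constructor
    · intro h; rw [← h]; ring
    · intro h
      apply mul_left_cancel₀ hmR
      rw [h]; ring

theorem continuous_adMatrix : Continuous fun u : U2 => adMatrix u.1 := by
  refine continuous_matrix fun i j => ?_
  simp only [adMatrix, Matrix.of_apply]
  have h : Continuous fun u : U2 => u.1 := continuous_subtype_val
  exact continuous_const.mul (Complex.continuous_re.comp
    ((continuous_const.matrix_mul ((h.matrix_mul continuous_const).matrix_mul
      h.matrix_conjTranspose)).matrix_trace))

theorem continuous_detHom : Continuous detHom := by
  have h : Continuous fun u : U2 => u.1.det := continuous_subtype_val.matrix_det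
  exact h.subtype_mk _

theorem continuous_scalarHom : Continuous scalarHom := by
  have h : Continuous fun z : Circle => (z : ℂ) • (1 : Matrix (Fin 2) (Fin 2) ℂ) :=
    Continuous.smul (f := fun z : Circle => (z : ℂ)) continuous_subtype_val continuous_const
  exact h.subtype_mk _

/-! ### Characters of the five groups -/

/-- The characters of a finite group are those of its abelianization, which has as many characters as
elements. -/
theorem card_characters (G : Type*) [Group G] [Finite G] :
    Nat.card (G →* Circle) = (commutator G).index := by
  have : NeZero (Monoid.exponent (Abelianization G)) :=
    ⟨Monoid.exponent_ne_zero_of_finite⟩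
  calc Nat.card (G →* Circle) = Nat.card (Abelianization G →* Circle) :=
        Nat.card_congr Abelianization.lift
    _ = Nat.card (Abelianization G →* Circleˣ) :=
        Nat.card_congr (toUnits (G := Circle)).monoidHomCongrRightEquiv
    _ = Nat.card (Abelianization G) :=
        CommGroup.card_monoidHom_of_hasEnoughRootsOfUnity _ _

theorem subsingleton_characters {G : Type*} [Group G] (h : commutator G = ⊤) :
    Subsingleton (G →* Circle) := by
  have key (χ : G →* Circle) : χ = 1 := by
    have : commutator G ≤ χ.ker := Abelianization.commutator_subset_ker χ
    rw [h, top_le_iff] at this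
    exact MonoidHom.ext fun g => by
      have : g ∈ χ.ker := by rw [this]; trivial
      exact this
  exact ⟨fun χ χ' => by rw [key χ, key χ']⟩

open scoped commutatorElement in
theorem commutator_perm_four :
    commutator (Equiv.Perm (Fin 4)) = alternatingGroup (Fin 4) := by
  apply le_antisymm alternatingGroup.commutator_perm_le
  rw [← Equiv.Perm.closure_three_cycles_eq_alternating, Subgroup.closure_le]
  intro g hg
  -- A 3-cycle `g` is conjugate to its inverse, so that `g = g⁻²` is a commutator.
  have hg' : g.IsThreeCycle := hg
  obtain ⟨h, hh⟩ := isConj_iff.1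
    (Equiv.Perm.isConj_iff_cycleType_eq.2 (hg'.trans hg'.inv.symm))
  have h3 : g ^ 3 = 1 := by rw [← hg'.orderOf, pow_orderOf_eq_one]
  have : g = ⁅h, g⁆ := by
    rw [commutatorElement_def, hh, eq_mul_inv_iff_mul_eq, eq_inv_iff_mul_eq_one, ← h3]
    simp [pow_succ]
  rw [SetLike.mem_coe, this]
  exact Subgroup.commutator_mem_commutator (Subgroup.mem_top _) (Subgroup.mem_top _)

theorem diagonal_mem_U2 (z w : Circle) :
    !![(z : ℂ), 0; 0, (w : ℂ)] ∈ Matrix.unitaryGroup (Fin 2) ℂ := by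
  rw [Matrix.mem_unitaryGroup_iff]
  ext i j
  fin_cases i <;> fin_cases j <;> simp [Matrix.mul_apply, Matrix.star_apply, Complex.mul_conj]

/-- Every special unitary matrix is conjugate in `U(2)` to a diagonal one: if `(p, q)` is a unit
eigenvector with eigenvalue `z`, then `(-q̄, p̄)` is one with eigenvalue `z̄`. -/
theorem exists_conj_diagonal (u : U2) (hu : u ∈ SU2) :
    ∃ (g : U2) (z : Circle), u = g * ⟨_, diagonal_mem_U2 z z⁻¹⟩ * g⁻¹ := by
  have hdet : u.1.det = 1 := hu
  have hadj : star u.1 = u.1.adjugate := by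
    calc star u.1 = star u.1 * (u.1 * u.1.adjugate) := by
          rw [Matrix.mul_adjugate, hdet, one_smul, mul_one]
      _ = u.1.adjugate := by
          rw [← mul_assoc, Matrix.mem_unitaryGroup_iff'.1 u.2, one_mul]
  have hb : star (u.1 0 1) = -u.1 1 0 := by
    have := congrFun (congrFun hadj 1) 0
    simpa [Matrix.star_apply, Matrix.adjugate_fin_two] using this
  have ha : star (u.1 0 0) = u.1 1 1 := by
    have := congrFun (congrFun hadj 0) 0
    simpa [Matrix.star_apply, Matrix.adjugate_fin_two] using this
  have ha' : star (u.1 1 1) = u.1 0 0 := by rw [← ha, star_star]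
  have hb' : star (u.1 1 0) = -u.1 0 1 := by rw [← neg_eq_iff_eq_neg.2 hb, star_neg, star_star]
  rw [Matrix.det_fin_two] at hdet
  obtain ⟨l, hl⟩ := IsAlgClosed.exists_root (u.1.charpoly)
    (by rw [Matrix.charpoly_degree_eq_dim]; simp)
  have hl' : (Matrix.scalar (Fin 2) l - u.1).det = 0 := by
    rw [← Matrix.eval_charpoly]; exact hl
  obtain ⟨v, hv0, hv⟩ := Matrix.exists_mulVec_eq_zero_iff.2 hl'
  have hv1 := congrFun hv 0
  have hv2 := congrFun hv 1
  simp [Matrix.mulVec, dotProduct, Fin.sum_univ_two] at hv1 hv2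
  have hN : 0 < Complex.normSq (v 0) + Complex.normSq (v 1) := by
    rcases eq_or_ne (v 0) 0 with h0 | h0
    · have h1 : v 1 ≠ 0 := fun h1 => hv0 (by ext i; fin_cases i <;> simp [h0, h1])
      have := Complex.normSq_pos.2 h1
      have := Complex.normSq_nonneg (v 0)
      linarith
    · have := Complex.normSq_pos.2 h0
      have := Complex.normSq_nonneg (v 1)
      linarith
  set r := Real.sqrt (Complex.normSq (v 0) + Complex.normSq (v 1)) with hr
  have hr2 : (r : ℂ) * r = Complex.normSq (v 0) + Complex.normSq (v 1) := by
    exact_mod_cast Real.mul_self_sqrt hN.le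
  have hr0 : (r : ℂ) ≠ 0 := by exact_mod_cast (Real.sqrt_pos.2 hN).ne'
  obtain ⟨p, hp⟩ : ∃ p, p = v 0 / r := ⟨_, rfl⟩
  obtain ⟨q, hq⟩ : ∃ q, q = v 1 / r := ⟨_, rfl⟩
  have hpq : p * star p + q * star q = 1 := by
    rw [hp, hq]
    simp only [Complex.star_def, map_div₀, Complex.conj_ofReal]
    rw [div_mul_div_comm, div_mul_div_comm, Complex.mul_conj, Complex.mul_conj, ← add_div, hr2,
      div_self]
    rw [← hr2]
    exact mul_ne_zero hr0 hr0
  have e1 : u.1 0 0 * p + u.1 0 1 * q = l * p := by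
    rw [hp, hq]; field_simp; linear_combination -hv1
  have e2 : u.1 1 0 * p + u.1 1 1 * q = l * q := by
    rw [hp, hq]; field_simp; linear_combination -hv2
  have e1' : u.1 1 1 * star p - u.1 1 0 * star q = star l * star p := by
    rw [← star_mul', ← e1, star_add, star_mul', star_mul', ha, hb]; ring
  have e2' : -u.1 0 1 * star p + u.1 0 0 * star q = star l * star q := by
    rw [← star_mul', ← e2, star_add, star_mul', star_mul', ha', hb']
  -- `u` preserves the norm of its eigenvector.
  have hll : l * star l = 1 := by
    linear_combination (-l * star l + 1) * hpq - star l * star p * e1 - star l * star q * e2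
      - (u.1 0 0 * p + u.1 0 1 * q) * e1' - (u.1 1 0 * p + u.1 1 1 * q) * e2'
      + (p * star p + q * star q) * hdet
  have hl1 : ‖l‖ = 1 := by
    rw [Complex.star_def, Complex.mul_conj, Complex.normSq_eq_norm_sq] at hll
    have : ‖l‖ ^ 2 = 1 := by exact_mod_cast hll
    nlinarith [norm_nonneg l]
  have hg : !![p, -star q; q, star p] ∈ Matrix.unitaryGroup (Fin 2) ℂ := by
    rw [Matrix.mem_unitaryGroup_iff']
    ext i j
    fin_cases i <;> fin_cases j <;> simp [Matrix.mul_apply, Matrix.star_apply] <;>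
      (try simp only [← Complex.star_def]) <;>
      first | linear_combination hpq | ring
  obtain ⟨z, hz⟩ : ∃ z : Circle, (z : ℂ) = l := ⟨⟨l, mem_sphere_zero_iff_norm.2 hl1⟩, rfl⟩
  have hz' : ((z⁻¹ : Circle) : ℂ) = star l := by rw [Circle.coe_inv_eq_conj, hz, Complex.star_def]
  refine ⟨⟨_, hg⟩, z, ?_⟩
  rw [eq_mul_inv_iff_mul_eq]
  apply Subtype.ext
  change u.1 * !![p, -star q; q, star p] =
    !![p, -star q; q, star p] * !![(z : ℂ), 0; 0, (z⁻¹ : Circle)]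
  rw [hz, hz']
  ext i j
  fin_cases i <;> fin_cases j <;> simp [Matrix.mul_apply] <;>
    try simp only [← Complex.star_def]
  · linear_combination e1
  · linear_combination -e2'
  · linear_combination e2
  · linear_combination e1'

open scoped commutatorElement in
/-- `SO(3)` is perfect: a rotation about an axis is a commutator of the rotation by half the angle and
a half turn about a perpendicular axis. -/
theorem commutator_SO3 : commutator SO3 = ⊤ := by
  refine (Subgroup.eq_top_iff' _).2 fun r => ?_
  obtain ⟨u, rfl⟩ := projSO3_surjective r
  obtain ⟨v, hv, z, -, rfl⟩ := exists_eq_SU2_mul_scalarHom u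
  rw [map_mul, projSO3_scalarHom, mul_one]
  obtain ⟨g, w, hg⟩ := exists_conj_diagonal _ hv
  obtain ⟨v, rfl⟩ := Circle.exists_pow_eq two_ne_zero w
  -- `diag(v², v⁻²)` is the commutator of `diag(v, v⁻¹)` and the first Pauli matrix.
  have hc : (⟨_, diagonal_mem_U2 (v ^ 2) (v ^ 2)⁻¹⟩ : U2) =
      ⁅(⟨_, diagonal_mem_U2 v v⁻¹⟩ : U2), ⟨pauli 0, pauli_mem 0⟩⁆ := by
    rw [commutatorElement_def, eq_mul_inv_iff_mul_eq, eq_mul_inv_iff_mul_eq]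
    apply Subtype.ext
    change !![((v ^ 2 : Circle) : ℂ), 0; 0, ((v ^ 2)⁻¹ : Circle)] * pauli 0 *
      !![(v : ℂ), 0; 0, (v⁻¹ : Circle)] = !![(v : ℂ), 0; 0, (v⁻¹ : Circle)] * pauli 0
    have hv : (v : ℂ) ≠ 0 := v.coe_ne_zero
    ext i j
    fin_cases i <;> fin_cases j <;> simp [pauli, Matrix.mul_apply] <;> field_simp
  rw [hg, hc, map_mul, map_mul, map_inv, map_commutatorElement]
  exact (inferInstance : (commutator SO3).Normal).conj_mem _
    (Subgroup.commutator_mem_commutator (Subgroup.mem_top _) (Subgroup.mem_top _)) _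

theorem subsingleton_characters_top : Subsingleton ((⊤ : Subgroup SO3) →* Circle) := by
  have := subsingleton_characters commutator_SO3
  exact (Subgroup.topEquiv (G := SO3)).monoidHomCongrLeftEquiv.subsingleton

theorem EasyType.finite_or_subsingleton_characters {τ : EasyType} {H : Subgroup SO3} (hH : τ.Is H) :
    Finite H ∨ Subsingleton (H →* Circle) := by
  cases τ
  · obtain rfl : H = ⊤ := hH
    exact Or.inr subsingleton_characters_top
  all_goals
    obtain ⟨e⟩ := hH
    exact Or.inl (Finite.of_equiv _ e.symm.toEquiv)

/-- `H` has `a(H)` characters. For the finite types this is the index of the commutator subgroup. -/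
theorem EasyType.card_characters {τ : EasyType} {H : Subgroup SO3} (hH : τ.Is H) :
    Nat.card (H →* Circle) = τ.a := by
  cases τ
  · obtain rfl : H = ⊤ := hH
    have := subsingleton_characters_top
    exact Nat.card_unique
  all_goals
    obtain ⟨e⟩ := hH
    rw [Nat.card_congr e.monoidHomCongrLeftEquiv, _root_.card_characters]
  · rw [commutator_alternatingGroup_eq_top (by simp), Subgroup.index_top]
    rfl
  · rw [commutator_perm_four, alternatingGroup.index_eq_two]
    rfl
  · rw [← alternatingGroup.kleinFour_eq_commutator (by simp)]
    have h := (alternatingGroup.kleinFour (Fin 4)).card_mul_index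
    rw [alternatingGroup.kleinFour_card_of_card_eq_four (by simp), nat_card_alternatingGroup] at h
    simp [Nat.factorial] at h
    change _ = 3
    omega
  · have : commutator (DihedralGroup 2) = ⊥ := by
      rw [commutator_eq_bot_iff_center_eq_top]
      refine (Subgroup.eq_top_iff' _).2 fun x => Subgroup.mem_center_iff.2 ?_
      revert x
      decide
    rw [this, Subgroup.index_bot, DihedralGroup.nat_card]
    rfl

/-! ### Commuting half turns -/

/-- `x` and `y` are distinct commuting involutions, so that they generate a Klein four-group. -/
structure KleinPair {G : Type*} [Group G] (x y : G) : Prop where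
  sq_left : x * x = 1
  sq_right : y * y = 1
  comm : x * y = y * x
  left_ne : x ≠ 1
  right_ne : y ≠ 1
  ne : x ≠ y

theorem KleinPair.map {G G' : Type*} [Group G] [Group G'] {x y : G} (h : KleinPair x y)
    (f : G →* G') (hf : Function.Injective f) : KleinPair (f x) (f y) where
  sq_left := by rw [← map_mul, h.sq_left, map_one]
  sq_right := by rw [← map_mul, h.sq_right, map_one]
  comm := by rw [← map_mul, h.comm, map_mul]
  left_ne := (map_ne_one_iff f hf).2 h.left_ne
  right_ne := (map_ne_one_iff f hf).2 h.right_ne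
  ne := hf.ne h.ne

theorem exists_SU2_lift (x : SO3) : ∃ X ∈ SU2, projSO3 X = x := by
  obtain ⟨u, rfl⟩ := projSO3_surjective x
  obtain ⟨v, hv, z, -, rfl⟩ := exists_eq_SU2_mul_scalarHom u
  exact ⟨v, hv, by rw [map_mul, projSO3_scalarHom, mul_one]⟩

theorem scalarHom_neg_one : scalarHom (-1) = -1 :=
  Subtype.ext (by
    rw [scalarHom_coe]
    change (-1 : ℂ) • (1 : Matrix (Fin 2) (Fin 2) ℂ) = -1
    rw [neg_one_smul])

theorem eq_or_eq_neg_of_projSO3_eq {u v : U2} (hu : u ∈ SU2) (hv : v ∈ SU2)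
    (h : projSO3 u = projSO3 v) : u = v ∨ u = -v := by
  obtain ⟨z, rfl⟩ := exists_eq_mul_scalarHom h
  rw [mem_SU2_iff] at hu hv
  rw [map_mul, hv, one_mul, detHom_scalarHom] at hu
  have hz : (z : ℂ) = 1 ∨ (z : ℂ) = -1 := by
    have : (z : ℂ) ^ 2 = 1 := by exact_mod_cast congrArg (fun w : Circle => (w : ℂ)) hu
    have h2 : ((z : ℂ) - 1) * ((z : ℂ) + 1) = 0 := by linear_combination this
    rcases mul_eq_zero.1 h2 with h3 | h3
    · exact Or.inl (sub_eq_zero.1 h3)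
    · exact Or.inr (eq_neg_of_add_eq_zero_left h3)
  rcases hz with hz | hz
  · left
    rw [show z = 1 from Circle.ext hz, map_one, mul_one]
  · right
    rw [show z = -1 from Circle.ext hz, scalarHom_neg_one, mul_neg, mul_one]

/-- The lifts of a half turn to `SU(2)` have square `-1`. -/
theorem sq_eq_neg_one_of_projSO3 {X : U2} (hX : X ∈ SU2) (h1 : projSO3 X ≠ 1)
    (h2 : projSO3 X * projSO3 X = 1) : X * X = -1 := by
  rcases eq_or_eq_neg_of_projSO3_eq (mul_mem hX hX) (one_mem _)
    (by rw [map_mul, h2, map_one] : projSO3 (X * X) = projSO3 1) with h | h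
  · -- `X` is a square root of one and of determinant one, so `X = ±1`.
    exfalso
    apply h1
    have hdet : X.1 0 0 * X.1 1 1 - X.1 0 1 * X.1 1 0 = 1 := by
      rw [← Matrix.det_fin_two]; exact hX
    have hs : X.1 * X.1 = 1 := congrArg Subtype.val h
    have e00 := congrFun (congrFun hs 0) 0
    have e01 := congrFun (congrFun hs 0) 1
    have e10 := congrFun (congrFun hs 1) 0
    have e11 := congrFun (congrFun hs 1) 1
    simp [Matrix.mul_apply] at e00 e01 e10 e11
    -- By the Cayley-Hamilton theorem `tr(X) X = X² + 1 = 2`.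
    have t2 : (X.1 0 0 + X.1 1 1) * (X.1 0 0 + X.1 1 1) = 4 := by
      linear_combination e00 + e11 + 2 * hdet
    have t0 : X.1 0 0 + X.1 1 1 ≠ 0 := by
      intro h0; rw [h0] at t2; norm_num at t2
    rw [← MonoidHom.mem_ker, projSO3_ker, Subgroup.mem_center_iff]
    intro g
    apply Subtype.ext
    change g.1 * X.1 = X.1 * g.1
    have z1 : X.1 0 1 = 0 := by
      apply mul_left_cancel₀ t0; linear_combination e01
    have z2 : X.1 1 0 = 0 := by
      apply mul_left_cancel₀ t0; linear_combination e10
    have z3 : X.1 0 0 = X.1 1 1 := by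
      apply mul_left_cancel₀ t0; linear_combination e00 - e11
    ext a b
    fin_cases a <;> fin_cases b <;> simp [Matrix.mul_apply, z1, z2, z3, mul_comm]
  · exact h

/-- Lifts to `SU(2)` of two distinct commuting half turns behave like the quaternions `i`, `j`. -/
theorem KleinPair.exists_lift {x y : SO3} (h : KleinPair x y) :
    ∃ X ∈ SU2, ∃ Y ∈ SU2, projSO3 X = x ∧ projSO3 Y = y ∧
      X * X = -1 ∧ Y * Y = -1 ∧ X * Y = -(Y * X) := by
  obtain ⟨X, hX, rfl⟩ := exists_SU2_lift x
  obtain ⟨Y, hY, rfl⟩ := exists_SU2_lift y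
  have hXX := sq_eq_neg_one_of_projSO3 hX h.left_ne h.sq_left
  have hYY := sq_eq_neg_one_of_projSO3 hY h.right_ne h.sq_right
  have hxy : projSO3 (X * Y) ≠ 1 := by
    rw [map_mul]
    intro h1
    apply h.ne
    rw [← mul_right_cancel_iff (a := projSO3 Y), h1, h.sq_right]
  have hXY : X * Y * (X * Y) = -1 := by
    refine sq_eq_neg_one_of_projSO3 (mul_mem hX hY) hxy ?_
    rw [map_mul]
    calc projSO3 X * projSO3 Y * (projSO3 X * projSO3 Y)
        = projSO3 X * projSO3 Y * (projSO3 Y * projSO3 X) := by rw [h.comm]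
      _ = projSO3 X * (projSO3 Y * projSO3 Y) * projSO3 X := by group
      _ = 1 := by rw [h.sq_right, mul_one, h.sq_left]
  refine ⟨X, hX, Y, hY, rfl, rfl, hXX, hYY, ?_⟩
  calc X * Y = X * Y * X * (Y * Y) * X := by
        rw [hYY, mul_neg, mul_one, neg_mul, mul_assoc (X * Y), hXX, mul_neg, mul_one, neg_neg]
    _ = X * Y * (X * Y) * (Y * X) := by simp only [mul_assoc]
    _ = -(Y * X) := by rw [hXY, neg_one_mul]

/-- The half turn about the bisector of the axes of `x` and `y` interchanges `x` and `y`: for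
lifts `X`, `Y` to `SU(2)` it is the image of `(X + Y) / √2`. -/
theorem KleinPair.exists_swap {x y : SO3} (h : KleinPair x y) :
    ∃ g : SO3, g * x * g⁻¹ = y ∧ g * y * g⁻¹ = x := by
  obtain ⟨X, hX, Y, hY, rfl, rfl, hXX, hYY, hXY⟩ := h.exists_lift
  have mXX : X.1 * X.1 = -1 := congrArg Subtype.val hXX
  have mYY : Y.1 * Y.1 = -1 := congrArg Subtype.val hYY
  have mXY : X.1 * Y.1 = -(Y.1 * X.1) := congrArg Subtype.val hXY
  have sX : star X.1 = -X.1 := by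
    calc star X.1 = -(star X.1 * (X.1 * X.1)) := by rw [mXX]; simp
      _ = -X.1 := by rw [← mul_assoc, Matrix.mem_unitaryGroup_iff'.1 X.2, one_mul]
  have sY : star Y.1 = -Y.1 := by
    calc star Y.1 = -(star Y.1 * (Y.1 * Y.1)) := by rw [mYY]; simp
      _ = -Y.1 := by rw [← mul_assoc, Matrix.mem_unitaryGroup_iff'.1 Y.2, one_mul]
  have hS : (X.1 + Y.1) * (X.1 + Y.1) = (-2 : ℂ) • (1 : Matrix (Fin 2) (Fin 2) ℂ) := by
    rw [add_mul, mul_add, mul_add, mXX, mYY, mXY]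
    module
  obtain ⟨r, hr⟩ : ∃ r : ℝ, r * r = 1 / 2 := ⟨_, Real.mul_self_sqrt (by norm_num)⟩
  have hrC : (r : ℂ) * r = 1 / 2 := by
    rw [← Complex.ofReal_mul, hr]; norm_num
  have hmem : (r : ℂ) • (X.1 + Y.1) ∈ Matrix.unitaryGroup (Fin 2) ℂ := by
    rw [Matrix.mem_unitaryGroup_iff, star_smul, star_add, sX, sY, ← neg_add, smul_mul_smul_comm,
      mul_neg, hS, Complex.star_def, Complex.conj_ofReal, hrC]
    module
  obtain ⟨g, hg⟩ : ∃ g : U2, g.1 = (r : ℂ) • (X.1 + Y.1) := ⟨⟨_, hmem⟩, rfl⟩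
  have h1 : g * X = Y * g := by
    apply Subtype.ext
    change g.1 * X.1 = Y.1 * g.1
    rw [hg, smul_mul_assoc, mul_smul_comm, add_mul, mul_add, mXX, mYY, add_comm]
  have h2 : g * Y = X * g := by
    apply Subtype.ext
    change g.1 * Y.1 = X.1 * g.1
    rw [hg, smul_mul_assoc, mul_smul_comm, add_mul, mul_add, mXX, mYY, add_comm]
  refine ⟨projSO3 g, ?_, ?_⟩
  · rw [← map_mul, h1, map_mul, mul_inv_cancel_right]
  · rw [← map_mul, h2, map_mul, mul_inv_cancel_right]

/-- The matrices commuting with a non-scalar `2 × 2` matrix commute with each other. -/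
theorem commute_of_commute_nonscalar {K : Type*} [Field K] {A B M : Matrix (Fin 2) (Fin 2) K}
    (hA : A * M = M * A) (hB : B * M = M * B) (hM : ¬ ∀ N, N * M = M * N) : A * B = B * A := by
  have ea := fun i j => congrFun (congrFun hA i) j
  have eb := fun i j => congrFun (congrFun hB i) j
  have a1 := ea 0 0
  have a2 := ea 0 1
  have a3 := ea 1 0
  have b1 := eb 0 0
  have b2 := eb 0 1
  have b3 := eb 1 0
  simp only [Matrix.mul_apply, Fin.sum_univ_two] at a1 a2 a3 b1 b2 b3
  by_contra hne
  apply hM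
  intro N
  -- If `A` and `B` do not commute, then their triples `(m₀₁, m₁₀, m₀₀ - m₁₁)` are not proportional.
  -- As both are proportional to the triple of `M`, the latter is zero.
  have c1 : A 0 1 * B 1 0 - A 1 0 * B 0 1 ≠ 0 ∨ A 0 1 * (B 0 0 - B 1 1) -
      B 0 1 * (A 0 0 - A 1 1) ≠ 0 ∨ A 1 0 * (B 0 0 - B 1 1) - B 1 0 * (A 0 0 - A 1 1) ≠ 0 := by
    by_contra! hc
    obtain ⟨k1, k2, k3⟩ := hc
    apply hne
    ext i j
    fin_cases i <;> fin_cases j <;> simp only [Matrix.mul_apply, Fin.sum_univ_two,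
      Fin.zero_eta, Fin.mk_one]
    · linear_combination k1
    · linear_combination -k2
    · linear_combination k3
    · linear_combination -k1
  have d1 : M 0 1 = 0 ∧ M 1 0 = 0 ∧ M 0 0 - M 1 1 = 0 := by
    rcases c1 with hc | hc | hc
    all_goals
      refine ⟨mul_left_cancel₀ hc ?_, mul_left_cancel₀ hc ?_, mul_left_cancel₀ hc ?_⟩
    all_goals grind
  obtain ⟨d1, d2, d3⟩ := d1
  rw [sub_eq_zero] at d3
  ext i j
  fin_cases i <;> fin_cases j <;> simp [Matrix.mul_apply, d1, d2, d3] <;> ring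

theorem KleinPair.symm {G : Type*} [Group G] {x y : G} (h : KleinPair x y) : KleinPair y x :=
  ⟨h.sq_right, h.sq_left, h.comm.symm, h.right_ne, h.left_ne, h.ne.symm⟩

theorem KleinPair.mul_right {G : Type*} [Group G] {x y : G} (h : KleinPair x y) :
    KleinPair x (x * y) where
  sq_left := h.sq_left
  sq_right := by
    rw [mul_assoc, ← mul_assoc y, ← h.comm, mul_assoc x y y, h.sq_right, mul_one, h.sq_left]
  comm := by rw [mul_assoc, ← h.comm]
  left_ne := h.left_ne
  right_ne h1 := h.ne (by rw [← mul_right_cancel_iff (a := y), h1, h.sq_right])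
  ne h1 := h.right_ne (by simpa using h1.symm)

theorem neg_one_ne_one_U2 : (-1 : U2) ≠ 1 := by
  rw [← scalarHom_neg_one, ← map_one scalarHom]
  exact scalarHom_injective.ne (Circle.neg_ne_self 1)

/-- A Klein four-group of rotations is its own centralizer. -/
theorem KleinPair.eq_of_commute {x y s : SO3} (h : KleinPair x y) (hx : s * x = x * s)
    (hy : s * y = y * s) : s = 1 ∨ s = x ∨ s = y ∨ s = x * y := by
  obtain ⟨X, hX, Y, hY, rfl, rfl, hXX, hYY, hXY⟩ := h.exists_lift
  obtain ⟨S, hS, rfl⟩ := exists_SU2_lift s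
  -- A unitary matrix commuting with `X` and `Y` is scalar, because `X` and `Y` do not commute.
  have key (T : U2) (h1 : T * X = X * T) (h2 : T * Y = Y * T) : projSO3 T = 1 := by
    rw [← MonoidHom.mem_ker, projSO3_ker, Subgroup.mem_center_iff]
    by_contra hc
    have hc' : X.1 * Y.1 = Y.1 * X.1 := by
      refine commute_of_commute_nonscalar (congrArg Subtype.val h1.symm)
        (congrArg Subtype.val h2.symm) fun hN => hc fun g => Subtype.ext (hN g.1)
    have hc2 : X * Y = Y * X := Subtype.ext hc'
    rw [hc2, ← neg_one_mul, eq_comm, mul_eq_right] at hXY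
    exact neg_one_ne_one_U2 hXY
  have hYX : Y * X = -(X * Y) := by rw [hXY, neg_neg]
  have hx' := eq_or_eq_neg_of_projSO3_eq (mul_mem hS hX) (mul_mem hX hS)
    (by rw [map_mul, hx, map_mul])
  have hy' := eq_or_eq_neg_of_projSO3_eq (mul_mem hS hY) (mul_mem hY hS)
    (by rw [map_mul, hy, map_mul])
  rcases hx' with hx' | hx' <;> rcases hy' with hy' | hy'
  · exact Or.inl (key S hx' hy')
  · right; left
    have := key (S * X) (by rw [hx', mul_assoc, hx'])
      (by rw [mul_assoc, hXY, mul_neg, ← mul_assoc, hy', neg_mul, neg_neg, mul_assoc])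
    rwa [map_mul, mul_eq_one_iff_eq_inv, inv_eq_of_mul_eq_one_left h.sq_left] at this
  · right; right; left
    have := key (S * Y) (by rw [mul_assoc, hYX, mul_neg, ← mul_assoc, hx', neg_mul, neg_neg,
        mul_assoc]) (by rw [hy', mul_assoc, hy'])
    rwa [map_mul, mul_eq_one_iff_eq_inv, inv_eq_of_mul_eq_one_left h.sq_right] at this
  · right; right; right
    have := key (S * (X * Y))
      (by rw [mul_assoc, mul_assoc, hYX, mul_neg, mul_neg, ← mul_assoc, hx', neg_mul, neg_neg,
        mul_assoc])
      (by
        calc S * (X * Y) * Y = -(S * Y) * (X * Y) := by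
              rw [hXY]; simp only [mul_assoc, neg_mul, mul_neg, hXY, neg_neg]
          _ = Y * (S * (X * Y)) := by rw [hy', neg_neg, mul_assoc])
    rwa [map_mul, map_mul, mul_eq_one_iff_eq_inv,
      inv_eq_of_mul_eq_one_left h.mul_right.sq_right] at this

/-- Elements of `K` over two distinct commuting half turns anticommute, so that `-1` is their
commutator. -/
theorem neg_one_mem_of_kleinPair {x y : SO3} (h : KleinPair x y) {K : Subgroup U2}
    (hx : x ∈ K.map projSO3) (hy : y ∈ K.map projSO3) : -1 ∈ K := by
  obtain ⟨X, hX, Y, hY, rfl, rfl, hXX, hYY, hXY⟩ := h.exists_lift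
  obtain ⟨u, hu, hux⟩ := hx
  obtain ⟨v, hv, hvy⟩ := hy
  obtain ⟨a, rfl⟩ := exists_eq_mul_scalarHom hux
  obtain ⟨b, rfl⟩ := exists_eq_mul_scalarHom hvy
  have ha (w : U2) : scalarHom a * w = w * scalarHom a :=
    (Subgroup.mem_center_iff.1 (scalarHom_mem_center a) w).symm
  have hb (w : U2) : scalarHom b * w = w * scalarHom b :=
    (Subgroup.mem_center_iff.1 (scalarHom_mem_center b) w).symm
  have huv : X * scalarHom a * (Y * scalarHom b) = -1 * (Y * scalarHom b * (X * scalarHom a)) := by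
    calc X * scalarHom a * (Y * scalarHom b) = X * (scalarHom a * Y) * scalarHom b := by
          simp only [mul_assoc]
      _ = X * Y * (scalarHom a * scalarHom b) := by rw [ha]; simp only [mul_assoc]
      _ = -1 * (Y * X * (scalarHom b * scalarHom a)) := by
          rw [hXY, ha, neg_one_mul, neg_mul]
      _ = -1 * (Y * (X * scalarHom b) * scalarHom a) := by simp only [mul_assoc]
      _ = _ := by rw [← hb]; simp only [mul_assoc]
  rw [← mul_inv_eq_iff_eq_mul] at huv
  rw [← huv]
  exact mul_mem (mul_mem hu hv) (inv_mem (mul_mem hv hu))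

theorem exists_kleinPair_SO3 : ∃ x y : SO3, KleinPair x y := by
  have hmem (d : Fin 3 → ℝ) (h1 : ∀ i, d i * d i = 1) (h2 : ∏ i, d i = 1) :
      Matrix.diagonal d ∈ Matrix.specialOrthogonalGroup (Fin 3) ℝ := by
    rw [Matrix.mem_specialOrthogonalGroup_iff, Matrix.mem_orthogonalGroup_iff,
      Matrix.diagonal_transpose, Matrix.diagonal_mul_diagonal,
      Matrix.det_diagonal]
    exact ⟨by simp [h1], h2⟩
  have h1 := hmem ![1, -1, -1] (by simp [Fin.forall_fin_succ]) (by simp [Fin.prod_univ_three])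
  have h2 := hmem ![-1, 1, -1] (by simp [Fin.forall_fin_succ]) (by simp [Fin.prod_univ_three])
  have hne {R S : SO3} (i : Fin 3) (h : R.1 i i ≠ S.1 i i) : R ≠ S := by
    rintro rfl
    exact h rfl
  refine ⟨⟨_, h1⟩, ⟨_, h2⟩, Subtype.ext ?_, Subtype.ext ?_, Subtype.ext ?_, hne 1 ?_, hne 0 ?_,
    hne 0 ?_⟩
  · change Matrix.diagonal _ * Matrix.diagonal _ = (1 : Matrix (Fin 3) (Fin 3) ℝ)
    rw [Matrix.diagonal_mul_diagonal, ← Matrix.diagonal_one]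
    congr 1
    ext i
    fin_cases i <;> simp
  · change Matrix.diagonal _ * Matrix.diagonal _ = (1 : Matrix (Fin 3) (Fin 3) ℝ)
    rw [Matrix.diagonal_mul_diagonal, ← Matrix.diagonal_one]
    congr 1
    ext i
    fin_cases i <;> simp
  · change Matrix.diagonal _ * Matrix.diagonal _ = Matrix.diagonal _ * Matrix.diagonal _
    rw [Matrix.diagonal_mul_diagonal, Matrix.diagonal_mul_diagonal]
    simp only [mul_comm]
  all_goals
    simp
    try norm_num

theorem kleinPair_dihedralGroup_two :
    KleinPair (DihedralGroup.sr 0 : DihedralGroup 2) (DihedralGroup.sr 1) := by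
  constructor <;> decide

theorem kleinPair_perm : KleinPair
    (Equiv.swap 0 1 * Equiv.swap 2 3 : Equiv.Perm (Fin 4)) (Equiv.swap 0 2 * Equiv.swap 1 3) := by
  constructor <;> decide

theorem exists_kleinPair_alternatingGroup_four :
    ∃ x y t : alternatingGroup (Fin 4), KleinPair x y ∧ t * x * t⁻¹ = y ∧ t * y * t⁻¹ = x * y ∧
      Subgroup.closure {x, y, t} = ⊤ := by
  have key : ∀ g : Equiv.Perm (Fin 4), Equiv.Perm.sign g = 1 →
      ∃ i j : Fin 2, ∃ k : Fin 3, g =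
        (Equiv.swap 0 1 * Equiv.swap 2 3) ^ i.1 * (Equiv.swap 0 2 * Equiv.swap 1 3) ^ j.1 *
          (Equiv.swap 1 2 * Equiv.swap 2 3) ^ k.1 := by decide
  have gen (x y t : alternatingGroup (Fin 4)) (hx : x.1 = Equiv.swap 0 1 * Equiv.swap 2 3)
      (hy : y.1 = Equiv.swap 0 2 * Equiv.swap 1 3) (ht : t.1 = Equiv.swap 1 2 * Equiv.swap 2 3) :
      Subgroup.closure {x, y, t} = ⊤ := by
    refine (Subgroup.eq_top_iff' _).2 fun g => ?_
    obtain ⟨i, j, k, hg⟩ := key g.1 (Equiv.Perm.mem_alternatingGroup.1 g.2)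
    rw [← hx, ← hy, ← ht] at hg
    rw [show g = x ^ i.1 * y ^ j.1 * t ^ k.1 from Subtype.ext hg]
    exact mul_mem (mul_mem (pow_mem (Subgroup.subset_closure (by simp)) _)
      (pow_mem (Subgroup.subset_closure (by simp)) _)) (pow_mem (Subgroup.subset_closure (by simp)) _)
  refine ⟨⟨Equiv.swap 0 1 * Equiv.swap 2 3, Equiv.Perm.mem_alternatingGroup.2 (by decide)⟩,
    ⟨Equiv.swap 0 2 * Equiv.swap 1 3, Equiv.Perm.mem_alternatingGroup.2 (by decide)⟩,
    ⟨Equiv.swap 1 2 * Equiv.swap 2 3, Equiv.Perm.mem_alternatingGroup.2 (by decide)⟩,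
    ⟨?_, ?_, ?_, ?_, ?_, ?_⟩, ?_, ?_, ?_⟩
  iterate 8 decide
  exact gen _ _ _ rfl rfl rfl

theorem exists_kleinPair_alternatingGroup_five :
    ∃ x y : alternatingGroup (Fin 5), KleinPair x y := by
  refine ⟨⟨Equiv.swap 0 1 * Equiv.swap 2 3, Equiv.Perm.mem_alternatingGroup.2 (by decide)⟩,
    ⟨Equiv.swap 0 2 * Equiv.swap 1 3, Equiv.Perm.mem_alternatingGroup.2 (by decide)⟩,
    ⟨?_, ?_, ?_, ?_, ?_, ?_⟩⟩ <;> decide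

theorem EasyType.exists_kleinPair {τ : EasyType} {H : Subgroup SO3} (hH : τ.Is H) :
    ∃ x y : H, KleinPair x y := by
  have transport {G : Type} [Group G] (e : H ≃* G) (h : ∃ x y : G, KleinPair x y) :
      ∃ x y : H, KleinPair x y := by
    obtain ⟨x, y, h⟩ := h
    exact ⟨_, _, h.map e.symm.toMonoidHom e.symm.injective⟩
  cases τ
  · obtain rfl : H = ⊤ := hH
    exact transport Subgroup.topEquiv exists_kleinPair_SO3
  all_goals obtain ⟨e⟩ := hH
  · exact transport e exists_kleinPair_alternatingGroup_five
  · exact transport e ⟨_, _, kleinPair_perm⟩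
  · obtain ⟨x, y, -, h, -⟩ := exists_kleinPair_alternatingGroup_four
    exact transport e ⟨x, y, h⟩
  · exact transport e ⟨_, _, kleinPair_dihedralGroup_two⟩

/-! ### Conjugation of characters -/

/-- The rotation `g` normalizes `H` and carries the character `χ` of `H` to `χ'`, in the sense that
`χ'(g h g⁻¹) = χ(h)`. -/
def ConjChar {H : Subgroup SO3} (g : SO3) (χ χ' : H →* Circle) : Prop :=
  H.map (MulAut.conj g).toMonoidHom = H ∧
    ∀ h h' : H, (h' : SO3) = g * h * g⁻¹ → χ' h' = χ h

theorem conjChar_one {H : Subgroup SO3} (χ : H →* Circle) : ConjChar 1 χ χ := by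
  refine ⟨?_, fun h h' e => ?_⟩
  · rw [map_one]
    exact Subgroup.map_id H
  · rw [show h' = h from Subtype.ext (by simpa using e)]

/-- It suffices to check conjugacy of characters of a finite group on generators. -/
theorem conjChar_of_closure {H : Subgroup SO3} [Finite H] {g : SO3} {χ χ' : H →* Circle}
    {S : Set H} (hS : Subgroup.closure S = ⊤)
    (h : ∀ s ∈ S, ∃ s' : H, (s' : SO3) = g * s * g⁻¹ ∧ χ' s' = χ s) : ConjChar g χ χ' := by
  have key (x : H) : ∃ x' : H, (x' : SO3) = g * x * g⁻¹ ∧ χ' x' = χ x := by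
    have hx : x ∈ Subgroup.closure S := by rw [hS]; trivial
    induction hx using Subgroup.closure_induction with
    | mem s hs => exact h s hs
    | one => exact ⟨1, by simp, by simp⟩
    | mul x y _ _ hx hy =>
      obtain ⟨x', hx, hx'⟩ := hx
      obtain ⟨y', hy, hy'⟩ := hy
      exact ⟨x' * y', by simp [hx, hy], by simp [hx', hy']⟩
    | inv x _ hx =>
      obtain ⟨x', hx, hx'⟩ := hx
      exact ⟨x'⁻¹, by simp [hx, mul_assoc], by simp [hx']⟩
  refine ⟨?_, fun x x' e => ?_⟩
  · apply Subgroup.eq_of_le_of_card_ge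
    · rintro _ ⟨x, hx, rfl⟩
      obtain ⟨x', hx', -⟩ := key ⟨x, hx⟩
      change g * x * g⁻¹ ∈ H
      rw [← hx']
      exact x'.2
    · exact (Subgroup.card_map_of_injective (MulAut.conj g).injective).ge
  · obtain ⟨y, hy, hy'⟩ := key x
    rw [← hy', show x' = y from Subtype.ext (e.trans hy.symm)]

theorem KleinPair.char_eq {G : Type*} [Group G] {x y : G} (h : KleinPair x y) (χ : G →* Circle) :
    χ y = 1 ∨ χ y = -1 := by
  have h1 : χ y * χ y = 1 := by rw [← map_mul, h.sq_right, map_one]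
  have h2 : ((χ y : ℂ) - 1) * ((χ y : ℂ) + 1) = 0 := by
    have : (χ y : ℂ) * χ y = 1 := by exact_mod_cast congrArg (fun w : Circle => (w : ℂ)) h1
    linear_combination this
  rcases mul_eq_zero.1 h2 with h3 | h3
  · exact Or.inl (Circle.ext (sub_eq_zero.1 h3))
  · exact Or.inr (Circle.ext (eq_neg_of_add_eq_zero_left h3))

/-- The nontrivial characters of a Klein four-group of rotations are conjugate: each has a kernel
of order two, and two of the three half turns can be interchanged. -/
theorem exists_conjChar_klein {H : Subgroup SO3} [Finite H] {x y : H} (hxy : KleinPair x y)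
    (hcl : Subgroup.closure {x, y} = ⊤) {χ χ' : H →* Circle} (hχ : χ ≠ 1) (hχ' : χ' ≠ 1) :
    ∃ g, ConjChar g χ χ' := by
  have ext_gen {a b : H} (hab : Subgroup.closure {a, b} = ⊤) {φ ψ : H →* Circle}
      (ha : φ a = ψ a) (hb : φ b = ψ b) : φ = ψ :=
    MonoidHom.eq_of_eqOn_dense hab (by rintro s (rfl | rfl) <;> assumption)
  have gen {a b c d : H} (hab : Subgroup.closure {a, b} = ⊤)
      (ha : a ∈ Subgroup.closure {c, d}) (hb : b ∈ Subgroup.closure {c, d}) :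
      Subgroup.closure {c, d} = ⊤ := by
    rw [← top_le_iff, ← hab, Subgroup.closure_le]
    rintro s (rfl | rfl) <;> assumption
  -- Generators `a`, `b` with `χ a = 1`.
  obtain ⟨a, b, hab, hcl', ha⟩ : ∃ a b : H, KleinPair a b ∧ Subgroup.closure {a, b} = ⊤ ∧
      χ a = 1 := by
    rcases hxy.symm.char_eq χ with h1 | h1
    · exact ⟨x, y, hxy, hcl, h1⟩
    rcases hxy.char_eq χ with h2 | h2
    · exact ⟨y, x, hxy.symm, by rwa [Set.pair_comm], h2⟩
    · refine ⟨x * y, x, hxy.mul_right.symm, gen hcl ?_ ?_, by rw [map_mul, h1, h2]; simp⟩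
      · exact Subgroup.subset_closure (by simp)
      · have : y = x⁻¹ * (x * y) := by group
        rw [this]
        exact mul_mem (inv_mem (Subgroup.subset_closure (by simp)))
          (Subgroup.subset_closure (by simp))
  have hb : χ b = -1 := (hab.char_eq χ).resolve_left fun hb =>
    hχ (ext_gen hcl' (by rw [ha]; rfl) (by rw [hb]; rfl))
  have swap {c : H} (hac : KleinPair a c) (hcl : Subgroup.closure {a, c} = ⊤) (hc : χ c = -1)
      (ha' : χ' a = -1) (hc' : χ' c = 1) : ∃ g, ConjChar g χ χ' := by
    obtain ⟨g, h1, h2⟩ := (hac.map H.subtype H.subtype_injective).exists_swap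
    refine ⟨g, conjChar_of_closure hcl ?_⟩
    rintro s (rfl | rfl)
    · exact ⟨c, h1.symm, by rw [hc', ha]⟩
    · exact ⟨a, h2.symm, by rw [ha', hc]⟩
  rcases hab.symm.char_eq χ' with ha' | ha'
  · have hb' : χ' b = -1 := (hab.char_eq χ').resolve_left fun hb' =>
      hχ' (ext_gen hcl' (by rw [ha']; rfl) (by rw [hb']; rfl))
    rw [ext_gen hcl' (ha'.trans ha.symm) (hb'.trans hb.symm)]
    exact ⟨1, conjChar_one χ⟩
  · rcases hab.char_eq χ' with hb' | hb'
    · exact swap hab hcl' hb ha' hb'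
    · refine swap hab.mul_right (gen hcl' ?_ ?_) (by rw [map_mul, ha, hb, one_mul]) ha'
        (by rw [map_mul, ha', hb']; simp)
      · exact Subgroup.subset_closure (by simp)
      · have : b = a⁻¹ * (a * b) := by group
        rw [this]
        exact mul_mem (inv_mem (Subgroup.subset_closure (by simp)))
          (Subgroup.subset_closure (by simp))

/-- A character of a tetrahedral group of rotations is conjugate to its inverse, by a rotation that
interchanges two half turns of the group. -/
theorem exists_conjChar_inv {H : Subgroup SO3} [Finite H] {x y t : H} (hxy : KleinPair x y)
    (htx : t * x * t⁻¹ = y) (hty : t * y * t⁻¹ = x * y) (hcl : Subgroup.closure {x, y, t} = ⊤)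
    (χ : H →* Circle) : ∃ g, ConjChar g χ χ⁻¹ := by
  have hχ1 : χ y = χ x := by rw [← htx]; simp
  have hχ2 : χ x = 1 := by
    have : χ (x * y) = χ y := by rw [← hty]; simp
    simpa using this
  have hH := hxy.map H.subtype H.subtype_injective
  obtain ⟨g, h1, h2⟩ := hH.exists_swap
  simp only [Subgroup.subtype_apply] at h1 h2 hH
  have htx' : (t : SO3) * x = y * t := by
    have := congrArg Subtype.val (mul_inv_eq_iff_eq_mul.1 htx); exact this
  have hty' : (t : SO3) * y = x * y * t := by
    have := congrArg Subtype.val (mul_inv_eq_iff_eq_mul.1 hty); exact this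
  have hgx : g * x = y * g := mul_inv_eq_iff_eq_mul.1 h1
  have hgy : g * y = x * g := mul_inv_eq_iff_eq_mul.1 h2
  have hgx' : g⁻¹ * x = y * g⁻¹ := by
    rw [inv_mul_eq_iff_eq_mul, ← mul_assoc, hgy, mul_inv_cancel_right]
  have hgy' : g⁻¹ * y = x * g⁻¹ := by
    rw [inv_mul_eq_iff_eq_mul, ← mul_assoc, hgx, mul_inv_cancel_right]
  -- Conjugation by `g` inverts the 3-cycle which `t` induces on the half turns, so that
  -- `g t g⁻¹ t` centralizes them.
  have hcx : g * t * g⁻¹ * t * x = x * (g * t * g⁻¹ * t) := by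
    calc g * t * g⁻¹ * t * x = g * t * (g⁻¹ * y) * t := by simp only [mul_assoc, htx']
      _ = g * (t * x) * g⁻¹ * t := by rw [hgy']; simp only [mul_assoc]
      _ = g * y * (t * g⁻¹ * t) := by rw [htx']; simp only [mul_assoc]
      _ = x * (g * t * g⁻¹ * t) := by rw [hgy]; simp only [mul_assoc]
  have hcy : g * t * g⁻¹ * t * y = y * (g * t * g⁻¹ * t) := by
    calc g * t * g⁻¹ * t * y = g * t * (g⁻¹ * x) * y * t := by simp only [mul_assoc, hty']
      _ = g * t * y * (g⁻¹ * y) * t := by rw [hgx']; simp only [mul_assoc]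
      _ = g * (t * y) * x * g⁻¹ * t := by rw [hgy']; simp only [mul_assoc]
      _ = g * x * y * (t * x) * g⁻¹ * t := by rw [hty']; simp only [mul_assoc]
      _ = g * x * (y * y) * t * g⁻¹ * t := by rw [htx']; simp only [mul_assoc]
      _ = y * (g * t * g⁻¹ * t) := by rw [hH.sq_right, mul_one, hgx]; simp only [mul_assoc]
  have hs : ∃ v : H, g * t * g⁻¹ * t = v ∧ χ v = 1 := by
    rcases hH.eq_of_commute hcx hcy with h | h | h | h
    · exact ⟨1, h, map_one χ⟩
    · exact ⟨x, h, hχ2⟩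
    · exact ⟨y, h, hχ1.trans hχ2⟩
    · exact ⟨x * y, h, by rw [map_mul, hχ1, hχ2, one_mul]⟩
  obtain ⟨v, hv, hχv⟩ := hs
  refine ⟨g, conjChar_of_closure hcl ?_⟩
  rintro s (rfl | rfl | rfl)
  · exact ⟨y, h1.symm, by rw [MonoidHom.inv_apply, hχ1, hχ2, inv_one]⟩
  · exact ⟨x, h2.symm, by rw [MonoidHom.inv_apply, hχ1, hχ2, inv_one]⟩
  · exact ⟨v * s⁻¹, by simp [← hv], by simp [hχv]⟩

theorem closure_image_mulEquiv_symm {G G' : Type*} [Group G] [Group G'] (e : G ≃* G') {S : Set G'}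
    (hS : Subgroup.closure S = ⊤) : Subgroup.closure (e.symm '' S) = ⊤ := by
  have := MonoidHom.map_closure e.symm.toMonoidHom S
  rw [hS, Subgroup.map_top_of_surjective _ e.symm.surjective] at this
  exact this.symm

theorem closure_dihedralGroup_two :
    Subgroup.closure {(DihedralGroup.sr 0 : DihedralGroup 2), DihedralGroup.sr 1} = ⊤ := by
  have key : ∀ g : DihedralGroup 2, ∃ i j : Fin 2,
      g = DihedralGroup.sr 0 ^ i.1 * DihedralGroup.sr 1 ^ j.1 := by decide
  refine (Subgroup.eq_top_iff' _).2 fun g => ?_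
  obtain ⟨i, j, rfl⟩ := key g
  exact mul_mem (pow_mem (Subgroup.subset_closure (by simp)) _)
    (pow_mem (Subgroup.subset_closure (by simp)) _)

/-- All nontrivial characters of `H` are conjugate under the normalizer of `H` in `SO(3)`. -/
theorem exists_conjChar {τ : EasyType} {H : Subgroup SO3} (hH : τ.Is H) {χ χ' : H →* Circle}
    (hχ : χ ≠ 1) (hχ' : χ' ≠ 1) : ∃ g, ConjChar g χ χ' := by
  have hcard := EasyType.card_characters hH
  have hpow (p : ℕ) [Fact p.Prime] (hp : Nat.card (H →* Circle) = p) :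
      ∃ k < p, χ' = χ ^ k ∧ k ≠ 0 := by
    obtain ⟨k, hk⟩ := mem_powers_of_prime_card hp hχ (g' := χ')
    have hk' : χ' = χ ^ (k % p) := by
      rw [← hp, pow_mod_natCard]
      exact hk.symm
    refine ⟨k % p, Nat.mod_lt _ (Fact.out (p := p.Prime)).pos, hk', fun h0 => hχ' ?_⟩
    rw [hk', h0, pow_zero]
  cases τ
  case rotation =>
    have := (Nat.card_eq_one_iff_unique.1 hcard).1
    exact absurd (Subsingleton.elim _ _) hχ
  case icosahedral =>
    have := (Nat.card_eq_one_iff_unique.1 hcard).1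
    exact absurd (Subsingleton.elim _ _) hχ
  case octahedral =>
    obtain ⟨k, hk, rfl, hk0⟩ := hpow 2 hcard
    obtain rfl : k = 1 := by omega
    exact ⟨1, by rw [pow_one]; exact conjChar_one χ⟩
  case tetrahedral =>
    obtain ⟨e⟩ := hH
    have : Finite H := Finite.of_equiv _ e.symm.toEquiv
    obtain ⟨k, hk, rfl, hk0⟩ := hpow 3 hcard
    obtain rfl | rfl : k = 1 ∨ k = 2 := by omega
    · exact ⟨1, by rw [pow_one]; exact conjChar_one χ⟩
    · have h3 : χ ^ 3 = 1 := by
        have := pow_card_eq_one' (x := χ)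
        rwa [hcard] at this
      rw [show χ ^ 2 = χ⁻¹ from eq_inv_of_mul_eq_one_left (by rw [← pow_succ, h3])]
      obtain ⟨x, y, t, hxy, htx, hty, hcl⟩ := exists_kleinPair_alternatingGroup_four
      refine exists_conjChar_inv (t := e.symm t) (hxy.map e.symm.toMonoidHom e.symm.injective)
        ?_ ?_ ?_ χ
      · rw [← htx]
        simp
      · change e.symm t * e.symm y * (e.symm t)⁻¹ = e.symm x * e.symm y
        rw [← map_mul e.symm x y, ← hty]
        simp
      · have := closure_image_mulEquiv_symm e hcl
        rw [Set.image_insert_eq, Set.image_pair] at this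
        exact this
  case klein =>
    obtain ⟨e⟩ := hH
    have : Finite H := Finite.of_equiv _ e.symm.toEquiv
    have h := kleinPair_dihedralGroup_two.map e.symm.toMonoidHom e.symm.injective
    refine exists_conjChar_klein h ?_ hχ hχ'
    have := closure_image_mulEquiv_symm e closure_dihedralGroup_two
    rw [Set.image_pair] at this
    exact this

/-! ### Full subgroups and characters -/

/-- The subgroup of `p⁻¹H` of all `u` with `det(u)ˢ = χ(p(u))`, for a character `χ` of `H`. -/
noncomputable def charLift (H : Subgroup SO3) (s : ℕ) (χ : H →* Circle) : Subgroup U2 where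
  carrier := {u | ∃ h : H, projSO3 u = h ∧ detHom u ^ s = χ h}
  one_mem' := ⟨1, by simp, by simp⟩
  mul_mem' := by
    rintro u v ⟨h, hu, hu'⟩ ⟨k, hv, hv'⟩
    exact ⟨h * k, by simp [hu, hv], by rw [map_mul, mul_pow, hu', hv', map_mul]⟩
  inv_mem' := by
    rintro u ⟨h, hu, hu'⟩
    exact ⟨h⁻¹, by simp [hu], by rw [map_inv, inv_pow, hu', map_inv]⟩

theorem mem_charLift {H : Subgroup SO3} {s : ℕ} {χ : H →* Circle} {u : U2} :
    u ∈ charLift H s χ ↔ ∃ h : H, projSO3 u = h ∧ detHom u ^ s = χ h := Iff.rfl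

/-- A finite `H` gives a finite union of closed sets. Otherwise `χ` is trivial,
and the condition reads `det(u)ˢ = 1`. -/
theorem isClosed_charLift {H : Subgroup SO3} (hH : Finite H ∨ Subsingleton (H →* Circle))
    (hcl : IsClosed (H : Set SO3)) (s : ℕ) (χ : H →* Circle) :
    IsClosed (charLift H s χ : Set U2) := by
  have hp : Continuous projSO3 := continuous_adMatrix.subtype_mk _
  rcases hH with _ | _
  · have : (charLift H s χ : Set U2) =
        ⋃ h : H, {u | projSO3 u = h} ∩ {u | detHom u ^ s = χ h} := by
      ext u
      simp [mem_charLift]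
    rw [this]
    exact isClosed_iUnion_of_finite fun h => (isClosed_eq hp continuous_const).inter
      (isClosed_eq (continuous_detHom.pow s) continuous_const)
  · have : (charLift H s χ : Set U2) = projSO3 ⁻¹' H ∩ {u | detHom u ^ s = 1} := by
      ext u
      rw [Subsingleton.elim χ 1]
      simp [mem_charLift]
    rw [this]
    exact (hcl.preimage hp).inter (isClosed_eq (continuous_detHom.pow s) continuous_const)

theorem charLift_inf_center (H : Subgroup SO3) (s : ℕ) (χ : H →* Circle) :
    charLift H s χ ⊓ Z2 = cyc (2 * s) := by
  ext u
  constructor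
  · rintro ⟨⟨h, hu, hu'⟩, hz⟩
    change u ∈ Z2 at hz
    rw [center_eq_range_scalarHom] at hz
    obtain ⟨z, rfl⟩ := hz
    rw [projSO3_scalarHom] at hu
    rw [show h = 1 from Subtype.ext hu.symm, map_one, detHom_scalarHom, ← pow_mul] at hu'
    exact scalarHom_mem_cyc.2 hu'
  · intro hu
    have hz := cyc_le_center _ hu
    refine ⟨?_, hz⟩
    rw [center_eq_range_scalarHom] at hz
    obtain ⟨z, rfl⟩ := hz
    rw [scalarHom_mem_cyc] at hu
    exact ⟨1, by simp [projSO3_scalarHom], by rw [detHom_scalarHom, ← pow_mul, hu, map_one]⟩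

/-- A lift of `h` to `U(2)` is corrected by a scalar `z` with the appropriate value of `z²ˢ`. -/
theorem charLift_mem_fullMeeting {H : Subgroup SO3}
    (hH : Finite H ∨ Subsingleton (H →* Circle)) (hcl : IsClosed (H : Set SO3)) {s : ℕ}
    (hs : s ≠ 0) (χ : H →* Circle) : charLift H s χ ∈ fullMeeting H (2 * s) := by
  refine ⟨⟨isClosed_charLift hH hcl s χ, ?_, ?_⟩, charLift_inf_center H s χ⟩
  · rintro u ⟨h, hu, -⟩
    change projSO3 u ∈ H
    rw [hu]
    exact h.2
  · ext x
    constructor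
    · rintro ⟨u, ⟨h, hu, -⟩, rfl⟩
      rw [hu]
      exact h.2
    · intro hx
      obtain ⟨u, rfl⟩ := projSO3_surjective x
      obtain ⟨z, hz⟩ := Circle.exists_pow_eq (mul_ne_zero two_ne_zero hs)
        (χ ⟨projSO3 u, hx⟩ * (detHom u ^ s)⁻¹)
      refine ⟨u * scalarHom z, ⟨⟨projSO3 u, hx⟩, ?_, ?_⟩, ?_⟩
      · rw [map_mul, projSO3_scalarHom, mul_one]
      · rw [map_mul, detHom_scalarHom, mul_pow, ← pow_mul, hz, mul_comm, inv_mul_cancel_right]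
      · rw [map_mul, projSO3_scalarHom, mul_one]

theorem charLift_injective {H : Subgroup SO3}
    (hH : Finite H ∨ Subsingleton (H →* Circle)) (hcl : IsClosed (H : Set SO3)) {s : ℕ}
    (hs : s ≠ 0) : Function.Injective (charLift H s) := by
  intro χ χ' e
  ext1 h
  have hmap := (charLift_mem_fullMeeting hH hcl hs χ).1.2.2
  have hh : (h : SO3) ∈ (charLift H s χ).map projSO3 := by rw [hmap]; exact h.2
  obtain ⟨u, hu, hu'⟩ := hh
  have hu2 : u ∈ charLift H s χ' := by rw [← e]; exact hu
  obtain ⟨k, hk, hk'⟩ := mem_charLift.1 hu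
  obtain ⟨l, hl, hl'⟩ := mem_charLift.1 hu2
  rw [← show k = h from Subtype.ext (hk.symm.trans hu'), ← hk', hl',
    show l = k from Subtype.ext (hl.symm.trans hk)]

/-- Every full subgroup meeting `Z` in `C_{2s}` comes from a character: `det(u)ˢ` depends only on
`p(u)` for `u ∈ K`, because `det(z)ˢ = z²ˢ` for scalar matrices. -/
theorem exists_eq_charLift {H : Subgroup SO3} {s : ℕ} {K : Subgroup U2}
    (hK : K ∈ fullMeeting H (2 * s)) : ∃ χ, K = charLift H s χ := by
  obtain ⟨⟨-, hle, hmap⟩, hZ⟩ := hK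
  have hwd {u v : U2} (hu : u ∈ K) (hv : v ∈ K) (h : projSO3 u = projSO3 v) :
      detHom u ^ s = detHom v ^ s := by
    obtain ⟨z, rfl⟩ := exists_eq_mul_scalarHom h
    have hz : scalarHom z ∈ cyc (2 * s) := by
      rw [← hZ]
      exact ⟨(K.mul_mem_cancel_left hv).1 hu, scalarHom_mem_center z⟩
    rw [map_mul, mul_pow, detHom_scalarHom, ← pow_mul, scalarHom_mem_cyc.1 hz, mul_one]
  have hex (h : H) : ∃ u ∈ K, projSO3 u = h := by
    have hh : (h : SO3) ∈ K.map projSO3 := by rw [hmap]; exact h.2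
    exact hh
  choose f hfK hf using hex
  refine ⟨⟨⟨fun h => detHom (f h) ^ s, ?_⟩, ?_⟩, ?_⟩
  · rw [hwd (hfK 1) (one_mem K) (by rw [hf]; simp), map_one, one_pow]
  · intro h k
    change detHom (f (h * k)) ^ s = detHom (f h) ^ s * detHom (f k) ^ s
    rw [← mul_pow, ← map_mul]
    exact hwd (hfK _) (mul_mem (hfK h) (hfK k)) (by rw [map_mul, hf, hf, hf]; rfl)
  · ext u
    constructor
    · intro hu
      refine ⟨⟨projSO3 u, hle hu⟩, rfl, hwd hu (hfK _) (by rw [hf])⟩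
    · rintro ⟨h, hu, hu'⟩
      obtain ⟨z, rfl⟩ := exists_eq_mul_scalarHom (hu.trans (hf h).symm)
      refine mul_mem (hfK h) ?_
      have hz : scalarHom z ∈ K ⊓ Z2 := by
        change detHom (f h * scalarHom z) ^ s = detHom (f h) ^ s at hu'
        rw [map_mul, mul_pow, mul_eq_left, detHom_scalarHom, ← pow_mul] at hu'
        rw [hZ]
        exact scalarHom_mem_cyc.2 hu'
      exact hz.1

theorem canonicalLift_eq_charLift (H : Subgroup SO3) (s : ℕ) :
    canonicalLift H s = charLift H s 1 := by
  apply le_antisymm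
  · refine sup_le ?_ ?_
    · rintro u ⟨hu, hu'⟩
      exact ⟨⟨projSO3 u, hu⟩, rfl, by rw [mem_SU2_iff.1 hu', one_pow]; rfl⟩
    · rw [← charLift_inf_center H s 1]
      exact inf_le_left
  · rintro u ⟨h, hu, hu'⟩
    obtain ⟨v, hv, z, hz, huv⟩ := exists_eq_SU2_mul_scalarHom u
    have hz2 : scalarHom z ∈ cyc (2 * s) := by
      rw [scalarHom_mem_cyc, pow_mul, hz]
      exact hu'
    rw [huv, map_mul, projSO3_scalarHom, mul_one] at hu
    rw [huv]
    refine Subgroup.mul_mem_sup ⟨?_, hv⟩ hz2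
    change projSO3 v ∈ H
    rw [hu]
    exact h.2

theorem preim_eq_sup (H : Subgroup SO3) : preim H = dbl H ⊔ Z2 := by
  apply le_antisymm
  · intro u hu
    obtain ⟨v, hv, z, -, rfl⟩ := exists_eq_SU2_mul_scalarHom u
    refine Subgroup.mul_mem_sup ⟨?_, hv⟩ (scalarHom_mem_center z)
    change projSO3 _ ∈ H at hu
    rwa [map_mul, projSO3_scalarHom, mul_one] at hu
  · refine sup_le inf_le_left ?_
    rw [Z2, ← projSO3_ker]
    intro u hu
    change projSO3 u ∈ H
    rw [MonoidHom.mem_ker.1 hu]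
    exact one_mem H

theorem dbl_inf_center (H : Subgroup SO3) : dbl H ⊓ Z2 = cyc 2 := by
  ext u
  constructor
  · rintro ⟨⟨-, hu⟩, hz⟩
    change u ∈ SU2 at hu
    change u ∈ Z2 at hz
    rw [center_eq_range_scalarHom] at hz
    obtain ⟨z, rfl⟩ := hz
    rw [mem_SU2_iff, detHom_scalarHom] at hu
    exact scalarHom_mem_cyc.2 hu
  · intro hu
    have hz := cyc_le_center _ hu
    rw [center_eq_range_scalarHom] at hz
    obtain ⟨z, rfl⟩ := hz
    rw [scalarHom_mem_cyc] at hu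
    refine ⟨⟨?_, ?_⟩, scalarHom_mem_center z⟩
    · change projSO3 _ ∈ H
      rw [projSO3_scalarHom]
      exact one_mem H
    · change _ ∈ SU2
      rw [mem_SU2_iff, detHom_scalarHom, hu]

theorem preim_mem_fullSubgroups {H : Subgroup SO3} (hcl : IsClosed (H : Set SO3)) :
    preim H ∈ fullSubgroups H :=
  ⟨hcl.preimage (continuous_adMatrix.subtype_mk _), le_rfl,
    Subgroup.map_comap_eq_self_of_surjective projSO3_surjective H⟩

/-- A full subgroup other than `p⁻¹H` meets `Z` in a finite cyclic group, whose order is even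
because `-1` is a commutator of elements lying over two commuting half turns. -/
theorem exists_mem_fullMeeting {H : Subgroup SO3} {x y : H} (hxy : KleinPair x y) {K : Subgroup U2}
    (hK : K ∈ fullSubgroups H) (hne : K ≠ preim H) : ∃ s, s ≠ 0 ∧ K ∈ fullMeeting H (2 * s) := by
  have hcl : IsClosed ((K.comap scalarHom : Subgroup Circle) : Set Circle) :=
    hK.1.preimage continuous_scalarHom
  rcases Circle.eq_top_or_eq_roots_of_isClosed _ hcl with h | ⟨n, hn, h⟩
  · exfalso
    apply hne
    refine le_antisymm hK.2.1 fun u hu => ?_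
    have hu' : projSO3 u ∈ K.map projSO3 := by rw [hK.2.2]; exact hu
    obtain ⟨k, hk, hku⟩ := hu'
    obtain ⟨z, rfl⟩ := exists_eq_mul_scalarHom hku.symm
    refine mul_mem hk ?_
    have : z ∈ K.comap scalarHom := by rw [h]; trivial
    exact this
  · have hneg : (-1 : Circle) ∈ K.comap scalarHom := by
      rw [Subgroup.mem_comap, scalarHom_neg_one]
      have hxy' := hxy.map H.subtype H.subtype_injective
      exact neg_one_mem_of_kleinPair hxy' (by rw [hK.2.2]; exact x.2) (by rw [hK.2.2]; exact y.2)
    rw [h] at hneg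
    have hev : Even n := by
      by_contra ho
      rw [(Nat.not_even_iff_odd.1 ho).neg_one_pow] at hneg
      exact Circle.neg_ne_self 1 hneg
    obtain ⟨s, rfl⟩ := hev.exists_two_nsmul
    rw [smul_eq_mul] at hn h
    refine ⟨s, right_ne_zero_of_mul hn, hK, ?_⟩
    ext u
    constructor
    · rintro ⟨hu, hz⟩
      change u ∈ Z2 at hz
      rw [center_eq_range_scalarHom] at hz
      obtain ⟨z, rfl⟩ := hz
      exact scalarHom_mem_cyc.2 ((h z).1 hu)
    · intro hu
      have hz := cyc_le_center _ hu
      refine ⟨?_, hz⟩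
      rw [center_eq_range_scalarHom] at hz
      obtain ⟨z, rfl⟩ := hz
      exact (h z).2 (scalarHom_mem_cyc.1 hu)

theorem finite_cyc {n : ℕ} (hn : n ≠ 0) : Finite (cyc n) := by
  have : NeZero n := ⟨hn⟩
  have hfin : Set.Finite {z : Circle | z ^ n = 1} := by
    refine Set.Finite.preimage (f := fun z : Circle => (z : ℂ)) Circle.coe_injective.injOn
      (s := {w : ℂ | w ^ n = 1}) ?_ |>.subset ?_
    · refine (Polynomial.nthRootsFinset n (1 : ℂ)).finite_toSet.subset fun w hw => ?_
      exact (Polynomial.mem_nthRootsFinset (Nat.pos_of_ne_zero hn) _).2 hw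
    · intro z hz
      change (z : ℂ) ^ n = 1
      exact_mod_cast congrArg (fun w : Circle => (w : ℂ)) hz
  refine Set.Finite.to_subtype ((hfin.image scalarHom).subset fun u hu => ?_)
  have hz := cyc_le_center _ hu
  rw [center_eq_range_scalarHom] at hz
  obtain ⟨z, rfl⟩ := hz
  exact ⟨z, scalarHom_mem_cyc.1 hu, rfl⟩

theorem even_card_cyc (s : ℕ) : Even (Nat.card (cyc (2 * s))) := by
  have hmem : (-1 : U2) ∈ cyc (2 * s) := by
    rw [← scalarHom_neg_one, scalarHom_mem_cyc, pow_mul]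
    simp
  have h2 : orderOf (⟨-1, hmem⟩ : cyc (2 * s)) = 2 := by
    refine orderOf_eq_prime (Subtype.ext (by simp)) fun h => neg_one_ne_one_U2 ?_
    exact congrArg Subtype.val h
  have hdvd := orderOf_dvd_natCard (⟨-1, hmem⟩ : cyc (2 * s))
  rw [h2] at hdvd
  exact even_iff_two_dvd.2 hdvd

/-- The elements of `p⁻¹H` are products of elements of `K` and central ones, so that a full
subgroup `K` is normalized by `p⁻¹H`. -/
theorem map_conj_eq_of_mem_preim {H : Subgroup SO3} {K : Subgroup U2} (hK : K.map projSO3 = H)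
    {g : U2} (hg : g ∈ preim H) : K.map (MulAut.conj g).toMonoidHom = K := by
  have hg' : projSO3 g ∈ K.map projSO3 := by rw [hK]; exact hg
  obtain ⟨k, hk, hkg⟩ := hg'
  obtain ⟨z, rfl⟩ := exists_eq_mul_scalarHom hkg.symm
  have hz : MulAut.conj (k * scalarHom z) = MulAut.conj k := by
    ext u : 1
    simp only [MulAut.conj_apply, _root_.mul_inv_rev]
    have : scalarHom z * u = u * scalarHom z :=
      (Subgroup.mem_center_iff.1 (scalarHom_mem_center z) u).symm
    rw [mul_assoc k, this]
    group
  rw [hz]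
  ext u
  constructor
  · rintro ⟨v, hv, rfl⟩
    exact mul_mem (mul_mem hk hv) (inv_mem hk)
  · intro hu
    exact ⟨k⁻¹ * u * k, mul_mem (mul_mem (inv_mem hk) hu) hk, by simp [mul_assoc]⟩

/-- Conjugate characters give conjugate full subgroups. -/
theorem map_conj_charLift {H : Subgroup SO3} (s : ℕ) {χ χ' : H →* Circle} {u : U2}
    (h : ConjChar (projSO3 u) χ χ') :
    (charLift H s χ).map (MulAut.conj u).toMonoidHom = charLift H s χ' := by
  obtain ⟨hmap, hχ⟩ := h
  have hdet (v : U2) : detHom (u * v * u⁻¹) = detHom v := by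
    rw [map_mul, map_mul, map_inv, mul_right_comm, mul_inv_cancel, one_mul]
  ext w
  constructor
  · rintro ⟨v, ⟨h, hv, hv'⟩, rfl⟩
    have hmem : projSO3 u * h * (projSO3 u)⁻¹ ∈ H := by
      have : projSO3 u * h * (projSO3 u)⁻¹ ∈ H.map (MulAut.conj (projSO3 u)).toMonoidHom :=
        ⟨h, h.2, rfl⟩
      rwa [hmap] at this
    refine ⟨⟨_, hmem⟩, ?_, ?_⟩
    · change projSO3 (u * v * u⁻¹) = _
      simp [hv]
    · change detHom (u * v * u⁻¹) ^ s = _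
      rw [hdet, hv', hχ h ⟨_, hmem⟩ rfl]
  · rintro ⟨h, hw, hw'⟩
    have hmem : (h : SO3) ∈ H.map (MulAut.conj (projSO3 u)).toMonoidHom := by
      rw [hmap]; exact h.2
    obtain ⟨k, hk, hk'⟩ := hmem
    refine ⟨u⁻¹ * w * u, ⟨⟨k, hk⟩, ?_, ?_⟩, by simp [mul_assoc]⟩
    · have : projSO3 u * k * (projSO3 u)⁻¹ = h := hk'
      rw [map_mul, map_mul, map_inv, hw, ← this]
      group
    · rw [← hχ ⟨k, hk⟩ h hk'.symm, ← hw', ← hdet (u⁻¹ * w * u)]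
      congr 2
      group

/-! ### Dimensions -/

open scoped Matrix.Norms.Operator in
/-- The operator norm only serves to make the derivative of the exponential map available. -/
theorem hasDerivAt_exp_smul_apply (X : Matrix (Fin 2) (Fin 2) ℂ) (i j : Fin 2) :
    HasDerivAt (fun t : ℝ => NormedSpace.exp (t • X) i j) (X i j) 0 := by
  have h := hasDerivAt_exp_smul_const (𝕂 := ℝ) X 0
  rw [zero_smul, NormedSpace.exp_zero, one_mul] at h
  exact ((Matrix.entryLinearMap ℝ ℂ i j).toContinuousLinearMap.hasFDerivAt.comp_hasDerivAt 0 h)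

/-- The derivative of `det(exp(tX))` at `t = 0` is the trace of `X`. -/
theorem trace_eq_zero_of_det_exp_pow {X : Matrix (Fin 2) (Fin 2) ℂ} {n : ℕ} (hn : n ≠ 0)
    (h : ∀ t : ℝ, (NormedSpace.exp (t • X)).det ^ n = 1) : X.trace = 0 := by
  have hd : HasDerivAt (fun t : ℝ => (NormedSpace.exp (t • X)).det) X.trace 0 := by
    have := ((hasDerivAt_exp_smul_apply X 0 0).mul (hasDerivAt_exp_smul_apply X 1 1)).sub
      ((hasDerivAt_exp_smul_apply X 0 1).mul (hasDerivAt_exp_smul_apply X 1 0))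
    simp only [Matrix.det_fin_two]
    refine this.congr_deriv ?_
    simp [NormedSpace.exp_zero, Matrix.trace_fin_two]
  have hp := hd.pow n
  have hc : HasDerivAt (fun _ : ℝ => (1 : ℂ)) 0 0 := hasDerivAt_const _ _
  have heq := hp.unique (hc.congr_of_eventuallyEq (.of_forall fun t => h t))
  simpa [NormedSpace.exp_zero, hn] using heq

/-- On `charLift H s χ` the determinant takes values in a finite group, on `p⁻¹H` it does not. -/
theorem lieDim_charLift_lt {H : Subgroup SO3} {s n : ℕ} (hs : s ≠ 0) (hn : n ≠ 0)
    {χ : H →* Circle} (hχ : χ ^ n = 1) : lieDim (charLift H s χ) < lieDim (preim H) := by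
  apply Submodule.finrank_lt_finrank_of_lt
  refine lt_of_le_of_ne (Submodule.span_mono fun X hX t => ?_) fun heq => ?_
  · obtain ⟨u, ⟨h, hu, -⟩, hu'⟩ := hX t
    refine ⟨u, ?_, hu'⟩
    change projSO3 u ∈ H
    rw [hu]
    exact h.2
  -- The Lie algebra of `charLift` consists of traceless matrices, while that of `p⁻¹H` contains
  -- the scalar matrix `i`.
  · have hker : Submodule.span ℝ {X : Matrix (Fin 2) (Fin 2) ℂ |
        ∀ t : ℝ, ∃ u ∈ charLift H s χ, u.1 = NormedSpace.exp (t • X)} ≤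
        LinearMap.ker (Matrix.traceLinearMap (Fin 2) ℝ ℂ) := by
      refine Submodule.span_le.2 fun X hX => ?_
      refine trace_eq_zero_of_det_exp_pow (mul_ne_zero hs hn) fun t => ?_
      obtain ⟨u, ⟨h, -, hu⟩, hu'⟩ := hX t
      rw [← hu', ← detHom_coe, ← Circle.coe_pow, pow_mul, hu, ← MonoidHom.pow_apply, hχ]
      rfl
    rw [heq] at hker
    have hmem : Matrix.diagonal (fun _ : Fin 2 => Complex.I) ∈ Submodule.span ℝ
        {X : Matrix (Fin 2) (Fin 2) ℂ | ∀ t : ℝ, ∃ u ∈ preim H, u.1 = NormedSpace.exp (t • X)} := by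
      refine Submodule.subset_span fun t => ⟨scalarHom (Circle.exp t), ?_, ?_⟩
      · change projSO3 _ ∈ H
        rw [projSO3_scalarHom]
        exact one_mem H
      · rw [← Matrix.diagonal_smul, Matrix.exp_diagonal, scalarHom_coe, Circle.coe_exp,
          Matrix.smul_one_eq_diagonal]
        congr 1
        ext i
        rw [Pi.coe_exp, ← Complex.exp_eq_exp_ℂ]
        simp
    have := hker hmem
    simp at this

/-! ### Conjugacy classes -/

theorem mem_conjClass_self (L K : Subgroup U2) : K ∈ conjClass L K :=
  ⟨1, one_mem L, by rw [map_one]; exact (Subgroup.map_id K).symm⟩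

theorem conjClass_eq_of_mem {L K K' : Subgroup U2} (h : K' ∈ conjClass L K) :
    conjClass L K' = conjClass L K := by
  obtain ⟨g, hg, rfl⟩ := h
  have hmap (a b : U2) : (K.map (MulAut.conj b).toMonoidHom).map (MulAut.conj a).toMonoidHom =
      K.map (MulAut.conj (a * b)).toMonoidHom := by
    rw [Subgroup.map_map, map_mul]
    rfl
  ext M
  constructor
  · rintro ⟨a, ha, rfl⟩
    exact ⟨a * g, mul_mem ha hg, hmap a g⟩
  · rintro ⟨a, ha, rfl⟩
    exact ⟨a * g⁻¹, mul_mem ha (inv_mem hg), by rw [hmap, inv_mul_cancel_right]⟩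

/-- The canonical lift is conjugate in `U(2)` to no other full subgroup over `H`. -/
theorem eq_canonicalLift_of_mem_conjClass {H : Subgroup SO3} {s : ℕ} {K : Subgroup U2}
    (hL : (canonicalLift H s).map projSO3 = H) (hK : K.map projSO3 = H)
    (h : K ∈ conjClass ⊤ (canonicalLift H s)) : K = canonicalLift H s := by
  obtain ⟨g, -, rfl⟩ := h
  have hcomp : projSO3.comp (MulAut.conj g).toMonoidHom =
      (MulAut.conj (projSO3 g)).toMonoidHom.comp projSO3 := by
    ext1 u
    simp
  rw [Subgroup.map_map, hcomp, ← Subgroup.map_map, hL] at hK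
  rw [canonicalLift_eq_charLift]
  exact map_conj_charLift s ⟨hK, fun _ _ _ => rfl⟩

theorem EasyType.isClosed {τ : EasyType} {H : Subgroup SO3} (hH : τ.Is H) :
    IsClosed (H : Set SO3) := by
  cases τ
  · obtain rfl : H = ⊤ := hH
    exact isClosed_univ
  all_goals
    obtain ⟨e⟩ := hH
    have : Finite H := Finite.of_equiv _ e.symm.toEquiv
    exact (Set.toFinite (H : Set SO3)).isClosed

theorem ncard_fullMeeting {τ : EasyType} {H : Subgroup SO3} (hH : τ.Is H) {s : ℕ} (hs : s ≠ 0) :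
    (fullMeeting H (2 * s)).ncard = τ.a := by
  have hfin := EasyType.finite_or_subsingleton_characters hH
  have hcl := EasyType.isClosed hH
  have : fullMeeting H (2 * s) = Set.range (charLift H s) := by
    ext K
    constructor
    · intro hK
      obtain ⟨χ, rfl⟩ := exists_eq_charLift hK
      exact ⟨χ, rfl⟩
    · rintro ⟨χ, rfl⟩
      exact charLift_mem_fullMeeting hfin hcl hs χ
  rw [this, ← Set.image_univ, Set.ncard_image_of_injective _ (charLift_injective hfin hcl hs),
    Set.ncard_univ, EasyType.card_characters hH]

theorem canonicalLift_mem_fullMeeting {τ : EasyType} {H : Subgroup SO3} (hH : τ.Is H) {s : ℕ}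
    (hs : s ≠ 0) : canonicalLift H s ∈ fullMeeting H (2 * s) := by
  rw [canonicalLift_eq_charLift]
  exact charLift_mem_fullMeeting (EasyType.finite_or_subsingleton_characters hH)
    (EasyType.isClosed hH) hs 1

/-- Any two full subgroups with the same intersection with `Z` that are not canonical lifts belong to
nontrivial characters of `H`, and these are conjugate. -/
theorem mem_conjClass_of_ne_canonicalLift {τ : EasyType} {H : Subgroup SO3} (hH : τ.Is H) {s : ℕ}
    {K K' : Subgroup U2} (hK : K ∈ fullMeeting H (2 * s)) (hK' : K' ∈ fullMeeting H (2 * s))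
    (hne : K ≠ canonicalLift H s) (hne' : K' ≠ canonicalLift H s) : K' ∈ conjClass ⊤ K := by
  obtain ⟨χ, rfl⟩ := exists_eq_charLift hK
  obtain ⟨χ', rfl⟩ := exists_eq_charLift hK'
  rw [canonicalLift_eq_charLift] at hne hne'
  obtain ⟨g, hg⟩ := exists_conjChar hH (χ := χ) (χ' := χ')
    (fun h => hne (by rw [h])) (fun h => hne' (by rw [h]))
  obtain ⟨u, rfl⟩ := projSO3_surjective g
  exact ⟨u, Subgroup.mem_top u, (map_conj_charLift s hg).symm⟩

/-- Full subgroups are normal in `p⁻¹H`, so that each is a conjugacy class of its own. -/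
theorem ncard_conjClasses_preim {τ : EasyType} {H : Subgroup SO3} (hH : τ.Is H) {s : ℕ}
    (hs : s ≠ 0) : (conjClasses (preim H) (fullMeeting H (2 * s))).ncard = τ.a := by
  rw [← ncard_fullMeeting hH hs]
  refine Set.InjOn.ncard_image fun K hK K' hK' h => ?_
  have hmem : K ∈ conjClass (preim H) K' := by
    rw [← h]
    exact mem_conjClass_self _ _
  obtain ⟨g, hg, rfl⟩ := hmem
  exact map_conj_eq_of_mem_preim hK'.1.2.2 hg

/-- The canonical lift is a class of its own, and all other full subgroups form a second class, which
is empty exactly when `H` has no nontrivial character, that is for `a(H) = 1`. -/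
theorem ncard_conjClasses_top {τ : EasyType} {H : Subgroup SO3} (hH : τ.Is H) {s : ℕ}
    (hs : s ≠ 0) : (conjClasses ⊤ (fullMeeting H (2 * s))).ncard = τ.b := by
  have hL := canonicalLift_mem_fullMeeting hH hs
  have hcard := ncard_fullMeeting hH hs
  have hb : τ.b = if τ.a = 1 then 1 else 2 := by cases τ <;> rfl
  by_cases hex : ∃ K ∈ fullMeeting H (2 * s), K ≠ canonicalLift H s
  · obtain ⟨K, hK, hne⟩ := hex
    have ha : τ.a ≠ 1 := by
      rw [← hcard]
      intro h
      obtain ⟨M, hM⟩ := Set.ncard_eq_one.1 h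
      rw [hM] at hK hL
      exact hne (hK.trans hL.symm)
    have hset : conjClasses ⊤ (fullMeeting H (2 * s)) =
        {conjClass ⊤ (canonicalLift H s), conjClass ⊤ K} := by
      ext C
      constructor
      · rintro ⟨M, hM, rfl⟩
        by_cases hML : M = canonicalLift H s
        · exact Or.inl (by rw [hML])
        · exact Or.inr (conjClass_eq_of_mem
            (mem_conjClass_of_ne_canonicalLift hH hK hM hne hML))
      · rintro (rfl | rfl)
        · exact ⟨_, hL, rfl⟩
        · exact ⟨_, hK, rfl⟩
    rw [hset, hb, if_neg ha]
    refine Set.ncard_pair fun h => hne ?_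
    refine eq_canonicalLift_of_mem_conjClass hL.1.2.2 hK.1.2.2 ?_
    rw [h]
    exact mem_conjClass_self _ _
  · push Not at hex
    have hset : fullMeeting H (2 * s) = {canonicalLift H s} := by
      ext M
      exact ⟨hex M, fun h => h ▸ hL⟩
    have ha : τ.a = 1 := by rw [← hcard, hset, Set.ncard_singleton]
    rw [hb, if_pos ha, hset, conjClasses, Set.image_singleton, Set.ncard_singleton]

/-- The characters of `H` form a finite group, so that each has finite order and the determinant takes
only finitely many values on a full subgroup other than `p⁻¹H`. -/
theorem lieDim_lt {τ : EasyType} {H : Subgroup SO3} (hH : τ.Is H) {K : Subgroup U2}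
    (hK : K ∈ fullSubgroups H) (hne : K ≠ preim H) : lieDim K < lieDim (preim H) := by
  obtain ⟨x, y, hxy⟩ := EasyType.exists_kleinPair hH
  obtain ⟨s, hs, hKs⟩ := exists_mem_fullMeeting hxy hK hne
  obtain ⟨χ, rfl⟩ := exists_eq_charLift hKs
  have hcard := EasyType.card_characters hH
  have ha : Nat.card (H →* Circle) ≠ 0 := by
    rw [hcard]
    cases τ <;> decide
  exact lieDim_charLift_lt hs ha pow_card_eq_one'

theorem mainTheorem5 (τ : EasyType) (H : Subgroup SO3) (hH : τ.Is H) :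
    -- the inverse image of `H` is the central product of the double cover of `H` with `Z`
    (preim H = dbl H ⊔ Z2 ∧ dbl H ⊓ Z2 = cyc 2) ∧
    -- (i)
    (∀ K ∈ fullSubgroups H, K ≠ preim H →
      Finite ↥(K ⊓ Z2) ∧ Even (Nat.card ↥(K ⊓ Z2))) ∧
    -- (ii)
    (fullSubgroups H = {dbl H ⊔ Z2} ∪ ⋃ s ∈ Set.Ici 1, fullMeeting H (2 * s) ∧
      (∀ K ∈ fullSubgroups H, K ≠ dbl H ⊔ Z2 → lieDim K < lieDim (dbl H ⊔ Z2)) ∧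
      (∀ s : ℕ, 1 ≤ s → (conjClasses (preim H) (fullMeeting H (2 * s))).ncard = τ.a) ∧
      (∀ K ∈ fullSubgroups H, (K.subgroupOf (preim H)).Normal) ∧
      (∀ s : ℕ, 1 ≤ s → canonicalLift H s ∈ fullMeeting H (2 * s))) ∧
    -- (iii)
    ((∀ s : ℕ, 1 ≤ s → ∀ K ∈ fullMeeting H (2 * s), ∀ K' ∈ fullMeeting H (2 * s),
        K ≠ canonicalLift H s → K' ≠ canonicalLift H s → K' ∈ conjClass ⊤ K) ∧
      conjClasses ⊤ {K ∈ fullSubgroups H | lieDim K = lieDim (dbl H ⊔ Z2)} =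
        {conjClass ⊤ (dbl H ⊔ Z2)} ∧
      (∀ s : ℕ, 1 ≤ s → (conjClasses ⊤ (fullMeeting H (2 * s))).ncard = τ.b)) := by
  obtain ⟨x, y, hxy⟩ := EasyType.exists_kleinPair hH
  have hcl := EasyType.isClosed hH
  have hne_zero {s : ℕ} (hs : 1 ≤ s) : s ≠ 0 := Nat.one_le_iff_ne_zero.1 hs
  refine ⟨⟨preim_eq_sup H, dbl_inf_center H⟩, ?_, ⟨?_, ?_, ?_, ?_, ?_⟩, ?_, ?_, ?_⟩
  · intro K hK hne
    obtain ⟨s, hs, hKs⟩ := exists_mem_fullMeeting hxy hK hne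
    rw [hKs.2]
    exact ⟨finite_cyc (mul_ne_zero two_ne_zero hs), even_card_cyc s⟩
  · rw [← preim_eq_sup]
    ext K
    simp only [Set.mem_union, Set.mem_singleton_iff, Set.mem_iUnion, Set.mem_Ici, exists_prop]
    constructor
    · intro hK
      by_cases hne : K = preim H
      · exact Or.inl hne
      · obtain ⟨s, hs, hKs⟩ := exists_mem_fullMeeting hxy hK hne
        exact Or.inr ⟨s, Nat.one_le_iff_ne_zero.2 hs, hKs⟩
    · rintro (rfl | ⟨s, -, hK⟩)
      · exact preim_mem_fullSubgroups hcl
      · exact hK.1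
  · intro K hK hne
    rw [← preim_eq_sup] at hne ⊢
    exact lieDim_lt hH hK hne
  · exact fun s hs => ncard_conjClasses_preim hH (hne_zero hs)
  · refine fun K hK => ⟨fun k hk g => ?_⟩
    rw [Subgroup.mem_subgroupOf] at hk ⊢
    rw [← map_conj_eq_of_mem_preim hK.2.2 g.2]
    exact ⟨k, hk, rfl⟩
  · exact fun s hs => canonicalLift_mem_fullMeeting hH (hne_zero hs)
  · exact fun s _ K hK K' hK' hne hne' => mem_conjClass_of_ne_canonicalLift hH hK hK' hne hne'
  · rw [← preim_eq_sup]
    have hset : {K ∈ fullSubgroups H | lieDim K = lieDim (preim H)} = {preim H} := by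
      ext K
      constructor
      · rintro ⟨hK, hdim⟩
        by_contra hne
        exact (lieDim_lt hH hK hne).ne hdim
      · rintro rfl
        exact ⟨preim_mem_fullSubgroups hcl, rfl⟩
    rw [hset, conjClasses, Set.image_singleton]
  · exact fun s hs => ncard_conjClasses_top hH (hne_zero hs)
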